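/- Let $k$ be the function field of a smooth, projective, geometrically connected curve $C$ over a finite field $\mathbb F_r$ of characteristic $p$, let $\infty$ be a fixed closed point of $C$ of degree $d_\infty$ over $\mathbb F_r$, and let $A$ be the ring of functions regular away from $\infty$. For a nonzero ideal $I$ of $A$ put $\deg I=\dim_{\mathbb F_r}A/I$. For a place $w$ of $k$ let $k_w$ be the completion of $k$ at $w$, $\bar k_w$ a fixed algebraic closure, and $\mathbb C_w$ the completion of $\bar k_w$, with the absolute value $|\cdot|_w$ extending the normalized one. Write $K=k_\infty$, fix a uniformizer $\pi$ of $K$, and fix $\pi_*\in\mathbb C_\infty$ with $\pi_*^{d_\infty}=\pi$. An element $\alpha\in k^*$ is *positive* if $\langle\alpha\rangle:=\alpha\,\pi^{-v_\infty(\alpha)}$ is a $1$-unit of $K$. Let $I\mapsto\langle I\rangle$ be the unique homomorphism from the monoid of nonzero ideals of $A$ to the $1$-units of $\mathbb C_\infty$ with $\langle \alpha A\rangle=\langle\alpha\rangle$ for all positive $\alpha\in A$. For $s=(x,y)\in\mathbb C_\infty^*\times\mathbb Z_p$ put $I^{s}=x^{\deg I}\langle I\rangle^{y}$, and $-s=(x^{-1},-y)$.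 Put $I^{s_1}=\pi_*^{-\deg I}\langle I\rangle$, $\mathbb V=k(\{I^{s_1}\}_I)\subset\mathbb C_\infty$, and let $\mathcal O_{\mathbb V}$ be the integral closure of $A$ in $\mathbb V$. Let $L(s)=L(x,y)=\sum_I b_I I^{-s}$, the sum over the nonzero ideals $I$ of $A$, be a Dirichlet series in the *motivic class* $\mathfrak M$, that is: 1. $b_I\in A$ for all $I$; 2. there is a real $t>0$ for which $L(s)$ converges absolutely in the half-plane $|x|_\infty\ge t$, meaning that $b_I I^{-s}\to0$ as $\deg I\to\infty$ for every $s=(x,y)$ with $|x|_\infty\geq t$; 3. for every integer $j\ge0$, the power series $L(\pi_*^{j}x,-j)$ in $x^{-1}$ is a polynomial in $x^{-1}$ with coefficients in $\mathcal O_{\mathbb V}$, and its degree is $O(\log j)$ as $j\to\infty$. Write $\delta_z$ for the Dirac measure at $z$. (i) Let $K_1=K(\{\langle I\rangle\}_I)$, and let $A_{1,\infty}$ be its ring of integers. For every compact open $U\subseteq A_{1,\infty}$ there is a polynomial $Q\in\mathbb C_\infty[X]$ such that, for every $t>0$ as in 2 and every $x\in\mathbb C_\infty$ with $|x|_\infty\ge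 t$, the series $$\mu_{L,x}(U)=\sum_I b_I\,x^{-\deg I}\,\delta_{\langle I\rangle}(U)$$ converges and equals $Q(x^{-1})$. (ii) Let $v\ne\infty$ be a place of $k$, let $\sigma:\mathbb V\to\bar k_v$ be an embedding over $k$, let $k_{\sigma,v}=k_v(\sigma(\mathbb V))$, and let $A_{\sigma,v}$ be its ring of integers. For every compact open $U\subseteq A_{\sigma,v}$ there is a polynomial $Q\in\mathbb C_v[X]$ such that, for every $t_v>1$ and every $x_v\in\mathbb C_v$ with $|x_v|_v\ge t_v$, the series $$\mu_{L,x_v}(U)=\sum_I b_I\,x_v^{-\deg I}\,\delta_{\sigma(I^{s_1})}(U)$$ (over all nonzero ideals $I$ of $A$) converges and equals $Q(x_v^{-1})$. -/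

import Mathlib

open scoped NNReal nonZeroDivisors WithZero

noncomputable section

namespace FunctionFieldMeasure

/-! ### Global function fields and their places -/

section Places

variable (Fr : Type*) [Field Fr] (k : Type*) [Field k] [Algebra Fr k]

/-- (For a finite field `Fr`.) `k` is the function field of a smooth, projective, geometrically connected curve over the
finite field `Fr`: a finite extension of a rational function field `Fr(T)` in which `Fr` is
algebraically closed. -/
class IsGlobalFunctionField : Prop where
  exists_finite : ∃ T : k, Transcendental Fr T ∧
    FiniteDimensional (IntermediateField.adjoin Fr {T}) k
  full_constants : ∀ a : k, IsAlgebraic Fr a → a ∈ Set.range (algebraMap Fr k)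

variable {Fr k}

/-- The valuation ring `{x | w x ≤ 1}`, as an `Fr`-algebra. -/
def valuationRing (w : Valuation k ℤᵐ⁰) (h : ∀ c : Fr, w (algebraMap Fr k c) ≤ 1) :
    Subalgebra Fr k :=
  { w.integer with algebraMap_mem' := h }

/-- The maximal ideal `{x | w x < 1}` of the valuation ring. -/
def valuationIdeal (w : Valuation k ℤᵐ⁰) (h : ∀ c : Fr, w (algebraMap Fr k c) ≤ 1) :
    Ideal (valuationRing w h) where
  carrier := {x | w (x : k) < 1}
  zero_mem' := by simp
  add_mem' := fun {a b} ha hb => by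
    simpa using w.map_add_lt ha hb
  smul_mem' := fun c x hx => by
    have hc : w (c : k) ≤ 1 := c.2
    have hx' : w (x : k) < 1 := hx
    have : w ((c : k) * (x : k)) < 1 := by
      rw [map_mul]
      exact lt_of_le_of_lt (mul_le_of_le_one_left' hc) hx'
    simpa using this

variable (Fr k) in
/-- A place of `k`, i.e. a closed point of the curve, given by its normalized discrete valuation
(in multiplicative notation: the value group is `ℤᵐ⁰` and the valuation is onto).
In a global function field every place has finite degree. -/
@[ext]
structure Place where
  val : Valuation k ℤᵐ⁰
  surj : Function.Surjective val
  le_one : ∀ c : Fr, val (algebraMap Fr k c) ≤ 1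
  finite_residue : Module.Finite Fr (valuationRing val le_one ⧸ valuationIdeal val le_one)

namespace Place

variable (P : Place Fr k)

/-- The additive valuation `v_P` (used on nonzero elements only). -/
def ord (a : k) : ℤ := -WithZero.log (P.val a)

/-- The local ring of the curve at `P`. -/
def ring : Subalgebra Fr k := valuationRing P.val P.le_one

/-- The degree `d_P` over `Fr` of the residue field at `P`. -/
def deg : ℕ := Module.finrank Fr (valuationRing P.val P.le_one ⧸ valuationIdeal P.val P.le_one)

theorem deg_pos : 0 < P.deg := by
  have := P.finite_residue
  have hne : valuationIdeal P.val P.le_one ≠ ⊤ := by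
    intro h
    have h1 : (1 : valuationRing P.val P.le_one) ∈ valuationIdeal P.val P.le_one := by
      rw [h]; trivial
    have h2 : P.val ((1 : valuationRing P.val P.le_one) : k) < 1 := h1
    simp at h2
  have : Nontrivial (valuationRing P.val P.le_one ⧸ valuationIdeal P.val P.le_one) :=
    Ideal.Quotient.nontrivial_iff.mpr hne
  exact Module.finrank_pos

/-- The cardinality `q_P = r ^ d_P` of the residue field at `P`. -/
def q : ℝ≥0 := (Nat.card Fr : ℝ≥0) ^ P.deg

theorem one_lt_q [Finite Fr] : 1 < P.q :=
  one_lt_pow₀ (by exact_mod_cast (Finite.one_lt_card : 1 < Nat.card Fr)) P.deg_pos.ne'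

variable [Finite Fr]

/-- The normalized absolute value `|a|_P = q_P ^ (- v_P(a))`, `|0|_P = 0`. -/
def abv : AbsoluteValue k ℝ where
  toFun a := (WithZeroMulInt.toNNReal (P.one_lt_q.ne_zero) (P.val a) : ℝ)
  map_mul' a b := by simp
  nonneg' a := NNReal.coe_nonneg _
  eq_zero' a := by
    constructor
    · intro h
      by_contra ha
      exact WithZeroMulInt.toNNReal_ne_zero P.one_lt_q.ne_zero ((P.val.ne_zero_iff).2 ha)
        (by exact_mod_cast h)
    · rintro rfl; simp
  add_le' a b := by
    have hm := (WithZeroMulInt.toNNReal_strictMono P.one_lt_q).monotone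
    have h := hm (P.val.map_add a b)
    rw [hm.map_max] at h
    exact_mod_cast h.trans (max_le_add_of_nonneg zero_le zero_le)

theorem abv_add_le_max (a b : k) : P.abv (a + b) ≤ max (P.abv a) (P.abv b) := by
  have hm := (WithZeroMulInt.toNNReal_strictMono P.one_lt_q).monotone
  have h := hm (P.val.map_add a b)
  rw [hm.map_max] at h
  exact_mod_cast h

/-! ### The completion at a place, its algebraic closure, and the completion of the latter -/

/-- The completion `k_P` of `k` at `P`. -/
def Completion : Type _ := P.abv.Completion

instance : NormedField P.Completion := inferInstanceAs (NormedField P.abv.Completion)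

instance : CompleteSpace P.Completion := inferInstanceAs (CompleteSpace P.abv.Completion)

/-- The embedding `k → k_P`. -/
def toCompletion : k →+* P.Completion :=
  (UniformSpace.Completion.coeRingHom : WithAbs P.abv →+* P.abv.Completion).comp
    (WithAbs.equiv P.abv).symm.toRingHom

instance : Algebra k P.Completion := P.toCompletion.toAlgebra

theorem norm_toCompletion (a : k) : ‖algebraMap k P.Completion a‖ = P.abv a :=
  UniformSpace.Completion.norm_coe (WithAbs.toAbs P.abv a)

instance : IsUltrametricDist P.Completion := by
  apply IsUltrametricDist.isUltrametricDist_of_forall_norm_add_le_max_norm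
  intro x y
  refine UniformSpace.Completion.induction_on₂ (α := WithAbs P.abv) (β := WithAbs P.abv)
    (p := fun x y : P.abv.Completion => ‖x + y‖ ≤ max ‖x‖ ‖y‖) x y ?_ ?_
  · exact isClosed_le (by fun_prop) (by fun_prop)
  · intro a b
    rw [← UniformSpace.Completion.coe_add]
    simp only [UniformSpace.Completion.norm_coe]
    exact P.abv_add_le_max a.ofAbs b.ofAbs

instance : NontriviallyNormedField P.Completion where
  non_trivial := by
    obtain ⟨a, ha⟩ := P.surj (WithZero.exp 1)
    refine ⟨algebraMap k P.Completion a, ?_⟩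
    rw [norm_toCompletion]
    have h := WithZeroMulInt.toNNReal_strictMono P.one_lt_q
      (show (1 : ℤᵐ⁰) < P.val a by rw [ha, ← WithZero.exp_zero, WithZero.exp_lt_exp]; norm_num)
    rw [map_one] at h
    exact_mod_cast h

/-- A fixed algebraic closure of `k_P`, normed by the unique extension of the absolute value. -/
def AlgCl : Type _ := AlgebraicClosure P.Completion

instance : Field P.AlgCl := inferInstanceAs (Field (AlgebraicClosure P.Completion))

instance : Algebra P.Completion P.AlgCl :=
  inferInstanceAs (Algebra P.Completion (AlgebraicClosure P.Completion))

instance : IsAlgClosure P.Completion P.AlgCl :=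
  inferInstanceAs (IsAlgClosure P.Completion (AlgebraicClosure P.Completion))

instance : Algebra.IsAlgebraic P.Completion P.AlgCl :=
  inferInstanceAs (Algebra.IsAlgebraic P.Completion (AlgebraicClosure P.Completion))

instance : NormedField P.AlgCl := spectralNorm.normedField P.Completion P.AlgCl

instance : Algebra k P.AlgCl :=
  ((algebraMap P.Completion P.AlgCl).comp (algebraMap k P.Completion)).toAlgebra

/-- The completion `ℂ_P` of the algebraic closure of `k_P`, with the extended norm. -/
def CC : Type _ := UniformSpace.Completion P.AlgCl

instance : NormedField P.CC := inferInstanceAs (NormedField (UniformSpace.Completion P.AlgCl))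

instance : CompleteSpace P.CC := inferInstanceAs (CompleteSpace (UniformSpace.Completion P.AlgCl))

/-- The embedding of the algebraic closure of `k_P` into `ℂ_P`. -/
def toCC : P.AlgCl →+* P.CC :=
  (UniformSpace.Completion.coeRingHom : P.AlgCl →+* UniformSpace.Completion P.AlgCl)

instance : Algebra P.Completion P.CC :=
  (P.toCC.comp (algebraMap P.Completion P.AlgCl)).toAlgebra

instance : Algebra k P.CC :=
  ((algebraMap P.Completion P.CC).comp (algebraMap k P.Completion)).toAlgebra

end Place

end Places

/-! ### The ring `A`, its ideals, and exponentiation of ideals -/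

section Infinity

variable {Fr : Type*} [Field Fr] {k : Type*} [Field k] [Algebra Fr k]

/-- The ring `A` of functions regular away from `∞`. -/
def affineRing (inf : Place Fr k) : Subalgebra Fr k :=
  ⨅ (P : Place Fr k) (_ : P ≠ inf), P.ring

/-- The monoid of nonzero ideals of `A`. -/
abbrev NzIdeal (inf : Place Fr k) : Type _ := ↥(Ideal (affineRing inf))⁰

/-- The degree of an ideal of `A`: `deg I = dim_{Fr} A / I`. -/
def idealDeg {inf : Place Fr k} (I : NzIdeal inf) : ℕ :=
  Module.finrank Fr (affineRing inf ⧸ (I : Ideal (affineRing inf)))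

variable [Finite Fr] {inf : Place Fr k}

/-- `π` is a uniformizer of `K = k_∞`, i.e. `v_∞(π) = 1`. -/
def IsUniformizer (π : inf.Completion) : Prop := ‖π‖ = ((inf.q : ℝ))⁻¹

/-- `α π ^ (- v_∞(α))`; for positive `α` this is the one-unit `⟨α⟩`. -/
def unitPart (π : inf.Completion) (α : k) : inf.Completion :=
  algebraMap k inf.Completion α * π ^ (-inf.ord α)

/-- `α = ζ π ^ n ⟨α⟩` is positive when `ζ = 1`, i.e. when `α π ^ (- n)` is a one-unit. -/
def IsPositive (π : inf.Completion) (α : k) : Prop :=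
  α ≠ 0 ∧ ‖unitPart π α - 1‖ < 1

/-- `φ` is a homomorphism from nonzero ideals to the one-units of `ℂ_∞` which sends a principal
ideal with positive generator `α` to `⟨α⟩`. There is exactly one such `φ`
(homomorphisms from nonzero ideals to a group are the same as
homomorphisms from the group of fractional ideals). -/
def IsAngleHom (π : inf.Completion) (φ : NzIdeal inf →* inf.CC) : Prop :=
  (∀ I, ‖φ I - 1‖ < 1) ∧
    ∀ (I : NzIdeal inf) (α : affineRing inf), IsPositive π (α : k) →
      (I : Ideal (affineRing inf)) = Ideal.span {α} →
      φ I = algebraMap inf.Completion inf.CC (unitPart π (α : k))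

open Classical in
/-- The homomorphism `I ↦ ⟨I⟩` (the trivial alternative never occurs). -/
def angleHom (π : inf.Completion) : NzIdeal inf →* inf.CC :=
  if h : ∃ φ, IsAngleHom π φ then h.choose else 1

/-- `u ^ y` for a one-unit `u` and `y = ∑ c_j p ^ j` in `ℤ_p`: the limit of the partial products
`∏_{j<n} (1 + (u - 1) ^ (p ^ j)) ^ c_j = u ^ (∑_{j<n} c_j p ^ j)`; recall that
`y.appr n = ∑_{j<n} c_j p ^ j`. -/
def oneUnitPow (p : ℕ) [Fact p.Prime] (u : inf.CC) (y : ℤ_[p]) : inf.CC :=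
  Filter.limUnder Filter.atTop (fun n : ℕ => u ^ (y.appr n))

/-- `I ^ s = x ^ (deg I) ⟨I⟩ ^ y` for `s = (x, y)` in `ℂ_∞ˣ × ℤ_p`. -/
def idealPow (p : ℕ) [Fact p.Prime] (π : inf.Completion) (x : inf.CC) (y : ℤ_[p])
    (I : NzIdeal inf) : inf.CC :=
  x ^ idealDeg I * oneUnitPow p (angleHom π I) y

/-- `I ^ {s_1} = π_* ^ (- deg I) ⟨I⟩`, where `s_1 = (π_*⁻¹, 1)`. -/
def idealPowOne (π : inf.Completion) (πs : inf.CC) (I : NzIdeal inf) : inf.CC :=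
  πs⁻¹ ^ idealDeg I * angleHom π I

/-- The value field `𝕍 = k({I ^ {s_1}})` inside `ℂ_∞`. -/
def valueField (π : inf.Completion) (πs : inf.CC) : IntermediateField k inf.CC :=
  IntermediateField.adjoin k (Set.range (idealPowOne π πs))

/-! ### Dirichlet series and the motivic class -/

/-- The coefficient `b_I` of a Dirichlet series, as an element of `ℂ_P`. -/
def coeffIn (P : Place Fr k) (b : NzIdeal inf → affineRing inf) (I : NzIdeal inf) : P.CC :=
  algebraMap k P.CC (b I : k)

/-- The Dirichlet series `∑_I b_I I ^ (-s)` converges absolutely in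
`{(x, y) | t ≤ |x|}`: its terms tend to `0` as `deg I → ∞`. Here `-s = (x⁻¹, -y)`. -/
def ConvergesAbsolutely (p : ℕ) [Fact p.Prime] (π : inf.Completion)
    (b : NzIdeal inf → affineRing inf) (t : ℝ) : Prop :=
  ∀ (x : inf.CC) (y : ℤ_[p]), t ≤ ‖x‖ →
    Filter.Tendsto (fun I => coeffIn inf b I * idealPow p π x⁻¹ (-y) I)
      (Filter.comap idealDeg Filter.atTop) (nhds 0)

/-- The coefficient of `x ^ (-d)` in the power series `L(x, y) = ∑_I b_I x ^ (-deg I) ⟨I⟩ ^ (-y)`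
(there are only finitely many ideals of a given degree). -/
def seriesCoeff (p : ℕ) [Fact p.Prime] (π : inf.Completion)
    (b : NzIdeal inf → affineRing inf) (y : ℤ_[p]) (d : ℕ) : inf.CC :=
  ∑ᶠ I : {I : NzIdeal inf // idealDeg I = d},
    coeffIn inf b I.1 * oneUnitPow p (angleHom π I.1) (-y)

/-- The coefficient of `x ^ (-d)` in the power series `L(π_* ^ j x, -j)`. -/
def specialCoeff (p : ℕ) [Fact p.Prime] (π : inf.Completion) (πs : inf.CC)
    (b : NzIdeal inf → affineRing inf) (j d : ℕ) : inf.CC :=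
  seriesCoeff p π b (-(j : ℤ_[p])) d * ((πs ^ j)⁻¹) ^ d

/-- The motivic class: Dirichlet series with coefficients in `A` which converge absolutely in a
half-plane and such that, for every `j ≥ 0`, `L(π_* ^ j x, -j)` is a polynomial in `x⁻¹` with
coefficients in the ring of `A`-integers of `𝕍`, of degree `O(log j)`. -/
structure IsMotivic (p : ℕ) [Fact p.Prime] (π : inf.Completion) (πs : inf.CC)
    (b : NzIdeal inf → affineRing inf) : Prop where
  half_plane : ∃ t : ℝ, 0 < t ∧ ConvergesAbsolutely p π b t
  special : ∃ z : ℕ → Polynomial inf.CC,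
    (∀ j d, (z j).coeff d = specialCoeff p π πs b j d) ∧
    (∀ j d, (z j).coeff d ∈ valueField π πs ∧ IsIntegral (affineRing inf) ((z j).coeff d)) ∧
    (fun j : ℕ => ((z j).natDegree : ℝ)) =O[Filter.atTop] (fun j : ℕ => Real.log j)

/-! ### The spaces `A_{1,∞}` and `A_{σ,v}` and the canonical measures on them -/

/-- `K_1 = K({⟨I⟩})`. -/
def K1 (π : inf.Completion) : IntermediateField inf.Completion inf.CC :=
  IntermediateField.adjoin inf.Completion (Set.range (angleHom π))

/-- `A_{1,∞}`, the maximal compact subring of `K_1`. -/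
def A1 (π : inf.Completion) : Set inf.CC := {z | z ∈ K1 π ∧ ‖z‖ ≤ 1}

/-- `k_{σ,v} = k_v(σ(𝕍))`, inside `ℂ_v`. -/
def kσ {π : inf.Completion} {πs : inf.CC} (v : Place Fr k)
    (σ : valueField π πs →ₐ[k] v.AlgCl) : IntermediateField v.Completion v.CC :=
  IntermediateField.adjoin v.Completion (Set.range fun a => v.toCC (σ a))

/-- `A_{σ,v}`, the ring of integers (maximal compact subring) of `k_{σ,v}`. -/
def Aσ {π : inf.Completion} {πs : inf.CC} (v : Place Fr k)
    (σ : valueField π πs →ₐ[k] v.AlgCl) : Set v.CC := {z | z ∈ kσ v σ ∧ ‖z‖ ≤ 1}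

/-- `I ^ {s_1}` as an element of the value field. -/
def idealPowOneV (π : inf.Completion) (πs : inf.CC) (I : NzIdeal inf) : valueField π πs :=
  ⟨idealPowOne π πs I, IntermediateField.subset_adjoin k _ ⟨I, rfl⟩⟩

open Classical in
/-- The value on `U ⊆ R` of the Dirac measure concentrated at `α`. -/
def dirac {C : Type*} [Zero C] [One C] {R : Set C} (α : C) (U : Set R) : C :=
  if α ∈ Subtype.val '' U then 1 else 0

/-- The terms of the series `μ_{L,x}(U) = ∑_I b_I x ^ (-deg I) δ_{⟨I⟩}(U)`. -/
def measTerm (π : inf.Completion) (b : NzIdeal inf → affineRing inf) (x : inf.CC)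
    (U : Set (A1 π)) (I : NzIdeal inf) : inf.CC :=
  coeffIn inf b I * x⁻¹ ^ idealDeg I * dirac (angleHom π I) U

/-- The canonical family of measures at `∞`:
`μ_{L,x} = ∑_I b_I x ^ (-deg I) δ_{⟨I⟩}` (where the series converges). -/
def canonicalMeasure (π : inf.Completion) (b : NzIdeal inf → affineRing inf) (x : inf.CC)
    (U : Set (A1 π)) : inf.CC :=
  ∑' I, measTerm π b x U I

/-- The terms of the series `μ_{L,x_v}(U) = ∑_I b_I x_v ^ (-deg I) δ_{σ(I ^ {s_1})}(U)`. -/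
def measTermV {π : inf.Completion} {πs : inf.CC} (b : NzIdeal inf → affineRing inf)
    (v : Place Fr k) (σ : valueField π πs →ₐ[k] v.AlgCl) (x : v.CC)
    (U : Set (Aσ v σ)) (I : NzIdeal inf) : v.CC :=
  coeffIn v b I * x⁻¹ ^ idealDeg I * dirac (v.toCC (σ (idealPowOneV π πs I))) U

/-- The canonical family of measures at `v`:
`μ_{L,x_v} = ∑_I b_I x_v ^ (-deg I) δ_{σ(I ^ {s_1})}` (where the series converges),
`I` ranging over all nonzero ideals. -/
def canonicalMeasureV {π : inf.Completion} {πs : inf.CC} (b : NzIdeal inf → affineRing inf)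
    (v : Place Fr k) (σ : valueField π πs →ₐ[k] v.AlgCl) (x : v.CC)
    (U : Set (Aσ v σ)) : v.CC :=
  ∑' I, measTermV b v σ x U I

end Infinity

end FunctionFieldMeasure

end

open FunctionFieldMeasure

namespace FunctionFieldMeasure

/-! ### Norms on the completions, and integral powers of one-units. -/

section Norms

variable {Fr : Type*} [Field Fr] [Finite Fr] {k : Type*} [Field k] [Algebra Fr k]

namespace Place

variable (P : Place Fr k)

/-! Write `z_I` for `⟨I⟩` at `∞`, or for `σ(I^{s_1})` at `v`. The coefficient of `x^{-d}` in the
measure of `U` is `a_d = ∑ b_I`, summed over the ideals of degree `d` with `z_I ∈ U`. It is an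
element of `A`, and everything reduces to showing `a_d = 0` for all large `d`.

Some polynomial `P` stays within `ρ < 1` of the indicator function of `U` on the ring of integers
(Kaplansky). In characteristic `p` the power `P^{p^m}` is then within `ρ^{p^m}` of it
(`exists_polynomial_pow_approx_indicator`). By the motivic condition, the power sum of `b_I z_I^j`
over `deg I = d` vanishes once `d` exceeds a bound of size `O(log j)`. For `j ≤ deg P · p^m` this
bound is linear in `m`, so the sum of `b_I P(z_I)^{p^m}` vanishes for `d ≥ c(m+1)`. Since `|b_I| ≤
X^{deg I}` for large degree, `|a_d|_v ≤ ρ^{p^m} X^d`. With `d ≤ c(m+2)` this is doubly exponentially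
small in `m`, while `|a_d|_∞ ≤ X^d`. The Liouville inequality `1 ≤ |a|_v |a|_∞^e` for nonzero `a ∈
A` (`exists_one_le_abv_mul_abv_pow`) forces `a_d = 0`; this is `sum_indicator_eq_zero`.

The Liouville inequality comes from counting dimensions in `A / aA`, together with the existence of
zeros of nonconstant functions. At `v`, values `z_I` outside the unit ball are harmless: the power
sums are integral, hence bounded, so the weights at each such value add up to zero
(`sum_filter_eq_zero_of_bounded`). -/

theorem norm_algebraMap_algCl (a : P.Completion) : ‖algebraMap P.Completion P.AlgCl a‖ = ‖a‖ :=
  spectralNorm_extends (K := P.Completion) (L := P.AlgCl) a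

theorem norm_toCC (a : P.AlgCl) : ‖P.toCC a‖ = ‖a‖ :=
  UniformSpace.Completion.norm_coe a

theorem norm_algebraMap_completion_CC (a : P.Completion) :
    ‖algebraMap P.Completion P.CC a‖ = ‖a‖ :=
  (P.norm_toCC _).trans (P.norm_algebraMap_algCl a)

theorem norm_algebraMap_CC (a : k) : ‖algebraMap k P.CC a‖ = P.abv a :=
  (P.norm_algebraMap_completion_CC _).trans (P.norm_toCompletion a)

instance : IsUltrametricDist P.AlgCl :=
  IsUltrametricDist.isUltrametricDist_of_forall_norm_add_le_max_norm fun x y =>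
    isNonarchimedean_spectralNorm (K := P.Completion) (L := P.AlgCl) x y

instance : IsUltrametricDist P.CC := by
  apply IsUltrametricDist.isUltrametricDist_of_forall_norm_add_le_max_norm
  intro x y
  refine UniformSpace.Completion.induction_on₂ (α := P.AlgCl) (β := P.AlgCl)
    (p := fun x y : UniformSpace.Completion P.AlgCl => ‖x + y‖ ≤ max ‖x‖ ‖y‖) x y ?_ ?_
  · exact isClosed_le (by fun_prop) (by fun_prop)
  · intro a b
    rw [← UniformSpace.Completion.coe_add]
    simp only [UniformSpace.Completion.norm_coe]
    exact IsUltrametricDist.norm_add_le_max a b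

theorem abv_apply (a : k) :
    P.abv a = (WithZeroMulInt.toNNReal (P.one_lt_q.ne_zero) (P.val a) : ℝ) := rfl

theorem abv_le_abv_iff (a b : k) : P.abv a ≤ P.abv b ↔ P.val a ≤ P.val b := by
  rw [abv_apply, abv_apply, NNReal.coe_le_coe,
    (WithZeroMulInt.toNNReal_strictMono P.one_lt_q).le_iff_le]

theorem abv_le_one_iff (a : k) : P.abv a ≤ 1 ↔ P.val a ≤ 1 := by
  simpa using P.abv_le_abv_iff a 1

theorem abv_lt_one_iff (a : k) : P.abv a < 1 ↔ P.val a < 1 := by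
  simpa using (P.abv_le_abv_iff 1 a).not

theorem exists_abv_lt_one : ∃ a : k, 0 < P.abv a ∧ P.abv a < 1 := by
  obtain ⟨a, ha⟩ := P.surj (WithZero.exp (-1))
  refine ⟨a, P.abv.pos ?_, ?_⟩
  · rintro rfl
    rw [map_zero] at ha
    exact WithZero.exp_ne_zero ha.symm
  · rw [abv_lt_one_iff, ha, ← WithZero.exp_zero, WithZero.exp_lt_exp]
    norm_num

end Place

theorem appr_natCast {p : ℕ} [Fact p.Prime] (j n : ℕ) (h : j < p ^ n) :
    ((j : ℤ_[p]).appr n) = j := by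
  have h1 := PadicInt.appr_spec n (j : ℤ_[p])
  rw [Ideal.mem_span_singleton] at h1
  have h2 : ((p : ℤ_[p]) ^ n) ∣ (((j : ℤ) - ((j : ℤ_[p]).appr n : ℤ) : ℤ) : ℤ_[p]) := by
    simpa using h1
  have h2 : (p : ℤ) ^ n ∣ (j : ℤ) - ((j : ℤ_[p]).appr n : ℤ) := by
    rw [← Ideal.mem_span_singleton, ← PadicInt.norm_le_pow_iff_mem_span_pow,
      PadicInt.norm_int_le_pow_iff_dvd] at h2
    exact_mod_cast h2
  have h3 : (j : ℤ) ≡ ((j : ℤ_[p]).appr n : ℤ) [ZMOD ((p ^ n : ℕ) : ℤ)] := by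
    rw [Int.modEq_comm, Int.modEq_iff_dvd]
    exact_mod_cast h2
  rw [Int.natCast_modEq_iff] at h3
  exact (Nat.ModEq.eq_of_lt_of_lt h3 h (PadicInt.appr_lt _ _)).symm

theorem oneUnitPow_natCast {inf : Place Fr k} (p : ℕ) [Fact p.Prime] (u : inf.CC) (j : ℕ) :
    oneUnitPow p u (j : ℤ_[p]) = u ^ j := by
  refine Filter.Tendsto.limUnder_eq (tendsto_const_nhds.congr' ?_)
  filter_upwards [Filter.eventually_ge_atTop j] with n hn
  rw [appr_natCast]
  exact hn.trans_lt (Nat.lt_pow_self (Fact.out : p.Prime).one_lt)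

end Norms

/-! ### Ultrametric polynomial approximation of indicator functions. -/

section Approximation

variable {C : Type*} [NormedField C] [IsUltrametricDist C]

theorem norm_mul_sub_one_lt {u v : C} (hu : ‖u - 1‖ < 1) (hv : ‖v - 1‖ < 1) :
    ‖u * v - 1‖ < 1 := by
  have h : u * v - 1 = (u - 1) * (v - 1) + ((u - 1) + (v - 1)) := by ring
  rw [h]
  refine (IsUltrametricDist.norm_add_le_max _ _).trans_lt (max_lt ?_ ?_)
  · rw [norm_mul]
    exact mul_lt_one_of_nonneg_of_lt_one_left (norm_nonneg _) hu hv.le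
  · exact (IsUltrametricDist.norm_add_le_max _ _).trans_lt (max_lt hu hv)

theorem norm_pow_sub_one_lt {u : C} (hu : ‖u - 1‖ < 1) (n : ℕ) : ‖u ^ n - 1‖ < 1 := by
  induction n with
  | zero => simp
  | succ n ih => rw [pow_succ]; exact norm_mul_sub_one_lt ih hu

theorem norm_prod_sub_one_lt {ι : Type*} (s : Finset ι) (u : ι → C)
    (hu : ∀ i ∈ s, ‖u i - 1‖ < 1) : ‖∏ i ∈ s, u i - 1‖ < 1 := by
  classical
  induction s using Finset.induction_on with
  | empty => simp
  | insert i s hi ih =>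
    rw [Finset.prod_insert hi]
    exact norm_mul_sub_one_lt (hu i (Finset.mem_insert_self i s))
      (ih fun j hj => hu j (Finset.mem_insert_of_mem hj))

theorem norm_le_one_of_sub_one {u : C} (hu : ‖u - 1‖ ≤ 1) : ‖u‖ ≤ 1 := by
  have := IsUltrametricDist.norm_add_le_max (u - 1) 1
  rw [sub_add_cancel, norm_one] at this
  exact this.trans (max_le hu le_rfl)

/-- Kaplansky's separation of a ball from finitely many others by a polynomial. -/
theorem exists_polynomial_separating {R : Set C} (hR : IsCompact R) {δ : ℝ}
    (a : C) (S : Finset C) (hS : ∀ s ∈ S, δ < ‖s - a‖) :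
    ∃ P : Polynomial C, (∀ z ∈ R, ‖z - a‖ ≤ δ → ‖P.eval z - 1‖ < 1) ∧
      ∀ s ∈ S, ∀ z ∈ R, ‖z - s‖ ≤ δ → ‖P.eval z‖ < 1 := by
  classical
  -- Centres are added in order of increasing distance from `a`. The factor `(z - s) / (a - s)` for
  -- the new, farthest centre `s` is then at most 1 in norm near the earlier centres.
  induction S using Finset.induction_on_max_value (fun s : C => ‖s - a‖) with
  | empty => exact ⟨1, by simp⟩
  | insert s S hs hmax ih =>
    obtain ⟨P, hP1, hP2⟩ := ih fun t ht => hS t (Finset.mem_insert_of_mem ht)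
    have hsa : δ < ‖s - a‖ := hS s (Finset.mem_insert_self s S)
    by_cases hδ : δ < 0
    · exact ⟨1, fun z _ hz => absurd (norm_nonneg _) (by linarith),
        fun s _ z _ hz => absurd (norm_nonneg (z - s)) (by linarith)⟩
    have hpos : 0 < ‖s - a‖ := (not_lt.1 hδ).trans_lt hsa
    have hne : a - s ≠ 0 := by
      rw [← norm_pos_iff, norm_sub_rev]; exact hpos
    obtain ⟨M, hM⟩ := hR.exists_bound_of_continuousOn (P.continuous.continuousOn (s := R))
    -- Near `s` the new factor is at most `δ / ‖s - a‖ < 1`, so a high power of it outweighs the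
    -- bound `M` for `P` on `R`.
    obtain ⟨N, hN⟩ := exists_pow_lt_of_lt_one
      (show (0 : ℝ) < 1 / (|M| + 1) by positivity) ((div_lt_one hpos).2 hsa)
    let h : Polynomial C := Polynomial.C (a - s)⁻¹ * (Polynomial.X - Polynomial.C s)
    have heval : ∀ z, h.eval z = (a - s)⁻¹ * (z - s) := fun z => by simp [h]
    have hnorm : ∀ z, ‖h.eval z‖ = ‖z - s‖ / ‖s - a‖ := fun z => by
      rw [heval, norm_mul, norm_inv, norm_sub_rev a s, div_eq_inv_mul]
    refine ⟨P * h ^ N, fun z hz hza => ?_, fun t ht z hz hzt => ?_⟩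
    · rw [Polynomial.eval_mul, Polynomial.eval_pow]
      refine norm_mul_sub_one_lt (hP1 z hz hza) (norm_pow_sub_one_lt ?_ N)
      have : h.eval z - 1 = (a - s)⁻¹ * (z - a) := by
        rw [heval]; field_simp; ring
      rw [this, norm_mul, norm_inv, norm_sub_rev a s, ← div_eq_inv_mul, div_lt_one hpos]
      exact hza.trans_lt hsa
    · rw [Polynomial.eval_mul, Polynomial.eval_pow, norm_mul, norm_pow, hnorm]
      rcases Finset.mem_insert.1 ht with rfl | ht
      · have h1 : ‖z - t‖ / ‖t - a‖ ≤ δ / ‖t - a‖ := by gcongr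
        have h2 : (‖z - t‖ / ‖t - a‖) ^ N < 1 / (|M| + 1) :=
          (pow_le_pow_left₀ (by positivity) h1 N).trans_lt hN
        have h3 : ‖P.eval z‖ ≤ |M| := (hM z hz).trans (le_abs_self M)
        calc ‖P.eval z‖ * (‖z - t‖ / ‖t - a‖) ^ N
            ≤ |M| * (1 / (|M| + 1)) := by gcongr
          _ < 1 := by rw [mul_one_div, div_lt_one (by positivity)]; linarith
      · have h1 : ‖z - s‖ / ‖s - a‖ ≤ 1 := by
          rw [div_le_one hpos]
          have e : z - s = (z - t) + ((t - a) + (a - s)) := by ring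
          rw [e]
          refine (IsUltrametricDist.norm_add_le_max _ _).trans (max_le (hzt.trans hsa.le) ?_)
          refine (IsUltrametricDist.norm_add_le_max _ _).trans (max_le (hmax t ht) ?_)
          rw [norm_sub_rev]
        calc ‖P.eval z‖ * (‖z - s‖ / ‖s - a‖) ^ N ≤ ‖P.eval z‖ * 1 := by
              gcongr
              exact pow_le_one₀ (by positivity) h1
          _ < 1 := by rw [mul_one]; exact hP2 t ht z hz hzt

/-- The indicator function of a relatively open compact part of a compact set is uniformly
approximated within the open unit ball by a polynomial. -/
theorem exists_polynomial_approx_indicator {R U : Set C} (hR : IsCompact R) (hUR : U ⊆ R)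
    (hU : IsCompact U) {δ : ℝ} (hδ : 0 < δ)
    (hopen : ∀ u ∈ U, ∀ z ∈ R, ‖z - u‖ ≤ δ → z ∈ U) :
    ∃ P : Polynomial C, ∃ ρ : ℝ, 0 < ρ ∧ ρ < 1 ∧
      (∀ z ∈ U, ‖P.eval z - 1‖ ≤ ρ) ∧ ∀ z ∈ R \ U, ‖P.eval z‖ ≤ ρ := by
  classical
  have cover : ∀ K : Set C, IsCompact K → ∃ S : Finset C, (∀ s ∈ S, s ∈ K) ∧
      ∀ z ∈ K, ∃ s ∈ S, ‖z - s‖ ≤ δ := by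
    intro K hK
    obtain ⟨t, htK, hfin, ht⟩ := hK.finite_cover_balls hδ
    refine ⟨hfin.toFinset, fun s hs => htK (hfin.mem_toFinset.1 hs), fun z hz => ?_⟩
    obtain ⟨s, hs, hzs⟩ := Set.mem_iUnion₂.1 (ht hz)
    exact ⟨s, hfin.mem_toFinset.2 hs, by rw [← dist_eq_norm]; exact (Metric.mem_ball.1 hzs).le⟩
  obtain ⟨S, hSR, hS⟩ := cover R hR
  obtain ⟨T, hTU, hT⟩ := cover U hU
  -- A point of `R` farther than `δ` from `a` lies within `δ` of a centre in `S`, which by the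
  -- ultrametric inequality is itself farther than `δ` from `a`.
  have hsep : ∀ a : C, ∃ P : Polynomial C, (∀ z ∈ R, ‖z - a‖ ≤ δ → ‖P.eval z - 1‖ < 1) ∧
      ∀ z ∈ R, ¬ ‖z - a‖ ≤ δ → ‖P.eval z‖ < 1 := by
    intro a
    obtain ⟨P, h1, h2⟩ := exists_polynomial_separating hR (δ := δ) a
      (S.filter fun s => δ < ‖s - a‖) (fun s hs => (Finset.mem_filter.1 hs).2)
    refine ⟨P, h1, fun z hz hza => ?_⟩
    obtain ⟨s, hs, hzs⟩ := hS z hz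
    refine h2 s (Finset.mem_filter.2 ⟨hs, ?_⟩) z hz hzs
    by_contra hcon
    refine hza ?_
    rw [← sub_add_sub_cancel z s a]
    exact (IsUltrametricDist.norm_add_le_max _ _).trans (max_le hzs (not_lt.1 hcon))
  choose P hP1 hP2 using hsep
  -- On `U` one factor `1 - P a` is small and the others are bounded by 1; off `U` every factor is
  -- close to 1.
  let Q : Polynomial C := 1 - ∏ a ∈ T, (1 - P a)
  have hQ : ∀ z, Q.eval z = 1 - ∏ a ∈ T, (1 - (P a).eval z) := fun z => by
    simp [Q, Polynomial.eval_prod]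
  have hin : ∀ z ∈ U, ‖Q.eval z - 1‖ < 1 := by
    intro z hz
    obtain ⟨a, ha, hza⟩ := hT z hz
    rw [hQ, sub_sub_cancel_left, norm_neg, ← Finset.mul_prod_erase T _ ha, norm_mul, norm_prod]
    refine mul_lt_one_of_nonneg_of_lt_one_left (norm_nonneg _) ?_ ?_
    · rw [norm_sub_rev]; exact hP1 a z (hUR hz) hza
    · refine Finset.prod_le_one (fun _ _ => norm_nonneg _) fun c _ => ?_
      rw [norm_sub_rev]
      by_cases hzc : ‖z - c‖ ≤ δ
      · exact (hP1 c z (hUR hz) hzc).le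
      · rw [sub_eq_add_neg]
        refine (IsUltrametricDist.norm_add_le_max _ _).trans (max_le (hP2 c z (hUR hz) hzc).le ?_)
        rw [norm_neg, norm_one]
  have hout : ∀ z ∈ R \ U, ‖Q.eval z‖ < 1 := by
    intro z hz
    rw [hQ, norm_sub_rev]
    refine norm_prod_sub_one_lt T _ fun a ha => ?_
    rw [sub_sub_cancel_left, norm_neg]
    refine hP2 a z hz.1 fun hza => hz.2 (hopen a (hTU a ha) z hz.1 hza)
  have hclosed : IsCompact (R \ U) := by
    have : R \ U = R \ ⋃ u ∈ U, Metric.ball u δ := by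
      ext z
      simp only [Set.mem_sdiff, Set.mem_iUnion₂, Metric.mem_ball, dist_eq_norm]
      refine and_congr_right fun hzR => not_congr ⟨fun hz => ⟨z, hz, by simpa using hδ⟩, ?_⟩
      rintro ⟨u, hu, hzu⟩
      exact hopen u hu z hzR hzu.le
    rw [this]
    exact hR.diff (isOpen_biUnion fun u _ => Metric.isOpen_ball)
  have hmax : ∀ (K : Set C), IsCompact K → ∀ f : C → C, Continuous f →
      (∀ z ∈ K, ‖f z‖ < 1) → ∃ ρ : ℝ, 0 < ρ ∧ ρ < 1 ∧ ∀ z ∈ K, ‖f z‖ ≤ ρ := by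
    intro K hK f hf h
    rcases K.eq_empty_or_nonempty with rfl | hne
    · exact ⟨1 / 2, by norm_num, by norm_num, by simp⟩
    · obtain ⟨z, hz, hzmax⟩ := hK.exists_isMaxOn hne hf.norm.continuousOn
      refine ⟨max (1 / 2) ‖f z‖, by positivity, max_lt (by norm_num) (h z hz),
        fun w hw => (hzmax hw).trans (le_max_right _ _)⟩
  obtain ⟨ρ₁, hρ₁, hρ₁', h1⟩ := hmax U hU (fun z => Q.eval z - 1)
    (Q.continuous.sub continuous_const) hin
  obtain ⟨ρ₂, hρ₂, hρ₂', h2⟩ := hmax (R \ U) hclosed (fun z => Q.eval z) Q.continuous hout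
  exact ⟨Q, max ρ₁ ρ₂, by positivity, max_lt hρ₁' hρ₂',
    fun z hz => (h1 z hz).trans (le_max_left _ _), fun z hz => (h2 z hz).trans (le_max_right _ _)⟩

/-- If the unit ball of a subfield has a nonempty compact open part, then it is compact. -/
theorem isCompact_unitBall {F : Subfield C} {R : Set C} (hRF : R = {z | z ∈ F ∧ ‖z‖ ≤ 1})
    {ϖ : C} (hϖF : ϖ ∈ F) (hϖ0 : 0 < ‖ϖ‖) (hϖ1 : ‖ϖ‖ < 1) {U : Set C} (hUR : U ⊆ R)
    (hU : IsCompact U) (hne : U.Nonempty) {δ : ℝ} (hδ : 0 < δ)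
    (hopen : ∀ u ∈ U, ∀ z ∈ R, ‖z - u‖ ≤ δ → z ∈ U) : IsCompact R := by
  obtain ⟨u, hu⟩ := hne
  have huR := hUR hu
  rw [hRF] at huR
  obtain ⟨n, hn⟩ := exists_pow_lt_of_lt_one hδ hϖ1
  have hne : ϖ ^ n ≠ 0 := pow_ne_zero _ (norm_pos_iff.1 hϖ0)
  -- Since `u + ϖ ^ n R` lies in `U`, rescaling a closed piece of the compact set `U` recovers all
  -- of `R`.
  have : R = (fun w => (w - u) / ϖ ^ n) '' (U ∩ Metric.closedBall u (‖ϖ‖ ^ n)) := by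
    ext z
    constructor
    · intro hz
      have hz' := hz
      rw [hRF] at hz'
      have hzn : ‖z * ϖ ^ n‖ ≤ ‖ϖ‖ ^ n := by
        rw [norm_mul, norm_pow]
        exact mul_le_of_le_one_left (by positivity) hz'.2
      refine ⟨u + z * ϖ ^ n, ⟨hopen u hu _ ?_ ?_, ?_⟩, ?_⟩
      · rw [hRF]
        refine ⟨F.add_mem huR.1 (F.mul_mem hz'.1 (F.pow_mem hϖF n)), ?_⟩
        exact (IsUltrametricDist.norm_add_le_max _ _).trans
          (max_le huR.2 (hzn.trans (pow_le_one₀ hϖ0.le hϖ1.le)))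
      · rw [add_sub_cancel_left]; exact hzn.trans hn.le
      · rw [Metric.mem_closedBall, dist_eq_norm, add_sub_cancel_left]; exact hzn
      · simp only [add_sub_cancel_left]
        exact mul_div_cancel_right₀ z hne
    · rintro ⟨w, ⟨hwU, hw⟩, rfl⟩
      have hwR := hUR hwU
      rw [hRF] at hwR ⊢
      rw [Metric.mem_closedBall, dist_eq_norm] at hw
      refine ⟨F.div_mem (F.sub_mem hwR.1 huR.1) (F.pow_mem hϖF n), ?_⟩
      rw [norm_div, norm_pow, div_le_one (by positivity)]
      exact hw
  rw [this]
  exact (hU.inter_right Metric.isClosed_closedBall).image (by fun_prop)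

open Classical in
/-- On the unit ball of a subfield in characteristic `p`, the indicator function of a compact open
set is approximated within `ρ ^ p ^ m` by the `p ^ m`-th power of a fixed polynomial. -/
theorem exists_polynomial_pow_approx_indicator (p : ℕ) [Fact p.Prime] [CharP C p] {F : Subfield C}
    {R : Set C} (hRF : R = {z | z ∈ F ∧ ‖z‖ ≤ 1})
    {ϖ : C} (hϖF : ϖ ∈ F) (hϖ0 : 0 < ‖ϖ‖) (hϖ1 : ‖ϖ‖ < 1)
    (U : Set R) (hU : IsCompact U) (hUo : IsOpen U) :
    ∃ P : Polynomial C, ∃ ρ : ℝ, 0 < ρ ∧ ρ < 1 ∧ ∀ z ∈ R, ∀ m : ℕ,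
      ‖P.eval z ^ p ^ m - if z ∈ Subtype.val '' U then 1 else 0‖ ≤ ρ ^ p ^ m := by
  have hU' : IsCompact (Subtype.val '' U) := hU.image continuous_subtype_val
  have hUR : Subtype.val '' U ⊆ R := by rintro _ ⟨z, _, rfl⟩; exact z.2
  obtain ⟨δ, hδ, hopen⟩ : ∃ δ : ℝ, 0 < δ ∧ ∀ u ∈ Subtype.val '' U, ∀ z ∈ R,
      ‖z - u‖ ≤ δ → z ∈ Subtype.val '' U := by
    obtain ⟨δ, hδ, h⟩ := hU.exists_cthickening_subset_open hUo le_rfl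
    refine ⟨δ, hδ, ?_⟩
    rintro _ ⟨u, hu, rfl⟩ z hz hzu
    refine ⟨⟨z, hz⟩, h (Metric.mem_cthickening_of_dist_le _ u δ U hu ?_), rfl⟩
    rw [Subtype.dist_eq, dist_eq_norm]; exact hzu
  -- For empty `U` compactness of `R` is not available, but the zero polynomial does.
  rcases (Subtype.val '' U).eq_empty_or_nonempty with hemp | hne
  · refine ⟨0, 1 / 2, by norm_num, by norm_num, fun z _ m => ?_⟩
    have : p ^ m ≠ 0 := pow_ne_zero _ (Fact.out : p.Prime).ne_zero
    simp [hemp, zero_pow this]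
  have hR := isCompact_unitBall hRF hϖF hϖ0 hϖ1 hUR hU' hne hδ hopen
  obtain ⟨P, ρ, hρ0, hρ1, h1, h2⟩ := exists_polynomial_approx_indicator hR hUR hU' hδ hopen
  refine ⟨P, ρ, hρ0, hρ1, fun z hz m => ?_⟩
  split_ifs with hzU
  · have : P.eval z ^ p ^ m - 1 = (P.eval z - 1) ^ p ^ m := by
      rw [sub_pow_char_pow, one_pow]
    rw [this, norm_pow]
    exact pow_le_pow_left₀ (norm_nonneg _) (h1 z hzU) _
  · rw [sub_zero, norm_pow]
    exact pow_le_pow_left₀ (norm_nonneg _) (h2 z ⟨hz, hzU⟩) _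

end Approximation

/-! ### Existence of zeros of nonconstant functions. -/

section ExistencePlaces

universe u

variable {F : Type*} {k : Type u} [Field F] [Field k] [Algebra F k]

open Polynomial in
/-- A linear relation over `F[b]` can be divided by a power of `b` until it is nontrivial
modulo `b`. -/
theorem exists_relation_coeff_zero_ne_zero {ι : Type*} [Fintype ι] {b : k} (hb : b ≠ 0)
    (x : ι → k) (f : ι → F[X]) (i : ι) (hi : f i ≠ 0) (hf : ∑ j, aeval b (f j) * x j = 0) :
    ∃ g : ι → F[X], (∃ j, (g j).coeff 0 ≠ 0) ∧ ∑ j, aeval b (g j) * x j = 0 := by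
  induction hN : (f i).natDegree generalizing f with
  | zero =>
    refine ⟨f, ⟨i, fun h => hi ?_⟩, hf⟩
    rw [Polynomial.eq_C_of_natDegree_eq_zero hN, h, C_0]
  | succ N ih =>
    by_cases h : ∃ j, (f j).coeff 0 ≠ 0
    · exact ⟨f, h, hf⟩
    push Not at h
    have hdiv : ∀ j, f j = X * (f j).divX := fun j => by
      conv_lhs => rw [← Polynomial.divX_mul_X_add (f j), h j, C_0, add_zero, mul_comm]
    refine ih (fun j => (f j).divX) (fun h0 => hi ?_) ?_ ?_
    · rw [hdiv i, h0, mul_zero]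
    · have : b * ∑ j, aeval b (f j).divX * x j = 0 := by
        rw [← hf, Finset.mul_sum]
        refine Finset.sum_congr rfl fun j _ => ?_
        conv_rhs => rw [hdiv j, map_mul, aeval_X, mul_assoc]
      exact (mul_eq_zero.1 this).resolve_left hb
    · rw [natDegree_divX_eq_natDegree_tsub_one, hN, Nat.add_sub_cancel]

open Polynomial IntermediateField.algebraAdjoinAdjoin in
/-- If `k` is finite over `F(b)`, then for every subalgebra `B` containing `b` the space
`B / bB` is finite-dimensional. -/
theorem finite_quotient_of_mem {b : k} (hb : b ≠ 0)
    [FiniteDimensional (IntermediateField.adjoin F {b}) k]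
    (B : Subalgebra F k) (hbB : b ∈ B) (J : Ideal B) (hJ : (⟨b, hbB⟩ : B) ∈ J) :
    Module.Finite F (B ⧸ J) := by
  classical
  have : Module.Free F (B ⧸ J) := Module.Free.of_divisionRing _ _
  refine Module.rank_lt_aleph0_iff.1 (lt_of_le_of_lt (rank_le
    (n := Module.finrank (IntermediateField.adjoin F {b}) k) ?_) (Cardinal.natCast_lt_aleph0))
  intro s hs
  by_contra hcard
  choose y hy using fun i : s => Ideal.Quotient.mk_surjective (i : B ⧸ J)
  -- More than `[k : F(b)]` lifts to `B` are dependent over `F(b)`, hence over `F[b]`. A relation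
  -- that is nontrivial modulo `b` reduces modulo `J ∋ b` to a nontrivial relation over `F`.
  have hdep : ¬ LinearIndependent (IntermediateField.adjoin F {b}) fun i : s => (y i : k) := by
    intro hli
    have := hli.fintype_card_le_finrank
    rw [Fintype.card_coe] at this
    exact hcard this
  rw [← LinearIndependent.iff_fractionRing (R := Algebra.adjoin F {b}),
    Fintype.not_linearIndependent_iff] at hdep
  obtain ⟨g, hg, i, hi⟩ := hdep
  have hpoly : ∀ c : Algebra.adjoin F {b}, ∃ f : F[X], aeval b f = (c : k) := fun c =>
    (Algebra.adjoin_singleton_eq_range_aeval F b).le c.2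
  choose f hf using fun j => hpoly (g j)
  obtain ⟨h, ⟨j, hj⟩, hrel⟩ := exists_relation_coeff_zero_ne_zero (F := F) hb
    (fun j => (y j : k)) f i
    (fun h0 => hi (by
      have := hf i
      rw [h0, map_zero] at this
      exact Subtype.ext this.symm))
    (by rw [← hg]; exact Finset.sum_congr rfl fun j _ => by rw [hf, Algebra.smul_def]; rfl)
  refine hj (Fintype.linearIndependent_iff.1 hs (fun j => (h j).coeff 0) ?_ j)
  have hB : ∑ j, aeval (⟨b, hbB⟩ : B) (h j) * y j = 0 := by
    apply Subtype.ext
    rw [ZeroMemClass.coe_zero, ← hrel]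
    push_cast
    refine Finset.sum_congr rfl fun j _ => ?_
    congr 1
  have := congrArg (Ideal.Quotient.mk J) hB
  rw [map_sum, map_zero] at this
  rw [← this]
  refine Finset.sum_congr rfl fun j _ => ?_
  have hsplit : aeval (⟨b, hbB⟩ : B) (h j) =
      aeval (⟨b, hbB⟩ : B) (h j).divX * ⟨b, hbB⟩ + algebraMap F B ((h j).coeff 0) := by
    conv_lhs => rw [← divX_mul_X_add (h j)]
    simp only [map_add, map_mul, aeval_X, aeval_C]
  rw [← hy j]
  change Ideal.Quotient.mk J ((h j).coeff 0 • y j) = _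
  rw [Ideal.Quotient.eq, hsplit, Algebra.smul_def]
  have : algebraMap F B ((h j).coeff 0) * y j - (aeval (⟨b, hbB⟩ : B) (h j).divX * ⟨b, hbB⟩ +
      algebraMap F B ((h j).coeff 0)) * y j =
      -(aeval (⟨b, hbB⟩ : B) (h j).divX * y j) * ⟨b, hbB⟩ := by ring
  rw [this]
  exact J.mul_mem_left _ hJ

-- The transcendence degree is 1, so `k` is algebraic over `F(b)`. It is generated there by `T` and
-- a finite spanning set of `k` over `F(T)`.
variable (F) in
theorem finiteDimensional_adjoin_of_transcendental [IsGlobalFunctionField F k] {b : k}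
    (hb : Transcendental F b) : FiniteDimensional (IntermediateField.adjoin F {b}) k := by
  obtain ⟨T, hT, hfin⟩ := IsGlobalFunctionField.exists_finite (Fr := F) (k := k)
  have halgT : Algebra.IsAlgebraic (Algebra.adjoin F (Set.range fun _ : PUnit.{u + 1} => T)) k := by
    rw [Set.range_const]
    have : Algebra.IsAlgebraic (IntermediateField.adjoin F {T}) k := inferInstance
    open IntermediateField.algebraAdjoinAdjoin in
    exact IsFractionRing.comap_isAlgebraic_iff (K := IntermediateField.adjoin F {T}).2 this
  have htr : Algebra.trdeg F k ≤ Cardinal.mk (PUnit.{u + 1}) := by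
    refine (Algebra.IsAlgebraic.trdeg_le_cardinalMk F
      (Set.range fun _ : PUnit.{u + 1} => T)).trans ?_
    exact Cardinal.mk_range_le
  have hbi : AlgebraicIndependent F fun _ : PUnit.{u + 1} => b :=
    algebraicIndependent_unique_type_iff.2 hb
  have hbas := (hbi.isTranscendenceBasis_of_trdeg_le_of_finite htr).isAlgebraic_field
  rw [Set.range_const] at hbas
  obtain ⟨S, hS⟩ := hfin.fg_top
  classical
  have h1 := IntermediateField.finiteDimensional_adjoin (K := IntermediateField.adjoin F {b})
    (S := (insert T S : Finset k)) fun x _ => (hbas.isAlgebraic x).isIntegral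
  set E := IntermediateField.adjoin (IntermediateField.adjoin F {b})
    ((insert T S : Finset k) : Set k)
  have hT' : T ∈ E := IntermediateField.subset_adjoin _ _ (by simp)
  have hSE : ∀ x ∈ S, x ∈ E := fun x hx => IntermediateField.subset_adjoin _ _ (by simp [hx])
  clear_value E
  have hTE : IntermediateField.adjoin F {T} ≤ E.restrictScalars F :=
    IntermediateField.adjoin_simple_le_iff.2 hT'
  have htop : ∀ x : k, x ∈ E := by
    intro x
    have hx : x ∈ Submodule.span (IntermediateField.adjoin F {T}) (S : Set k) := by
      rw [hS]; trivial
    refine Submodule.span_induction (p := fun x _ => x ∈ E) (fun x hx => hSE x hx) E.zero_mem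
      (fun x y _ _ hx hy => E.add_mem hx hy) (fun a x _ hx => ?_) hx
    exact E.mul_mem (hTE a.2) hx
  exact Module.Finite.of_surjective E.val.toLinearMap fun x => ⟨⟨x, htop x⟩, rfl⟩

/-- Every transcendental element of a global function field has a zero. -/
theorem exists_place_lt_one [IsGlobalFunctionField F k] {b : k} (hb : Transcendental F b) :
    ∃ P : Place F k, P.val b < 1 := by
  have hb0 : b ≠ 0 := by rintro rfl; exact hb (isAlgebraic_zero)
  have := finiteDimensional_adjoin_of_transcendental F hb
  let A := Algebra.adjoin F {b}
  have hbA : b ∈ A := Algebra.self_mem_adjoin_singleton F b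
  have hI : Ideal.span {(⟨b, hbA⟩ : A.toSubring)} ≠ ⊤ := by
    rw [Ne, Ideal.span_singleton_eq_top]
    rintro hu
    obtain ⟨⟨c, hc⟩, hbc⟩ := isUnit_iff_exists_inv.1 hu
    have hc' : c ∈ Algebra.adjoin F {b} := hc
    rw [Algebra.adjoin_singleton_eq_range_aeval] at hc'
    obtain ⟨f, rfl⟩ := hc'
    have h1 : b * Polynomial.aeval b f = 1 := congrArg Subtype.val hbc
    refine hb ⟨Polynomial.X * f - 1, fun h0 => ?_, by simp [h1]⟩
    have := congrArg (Polynomial.coeff · 0) h0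
    simp at this
  -- As `b` is not a unit of `F[b]`, some valuation ring of `k` containing `F[b]` has `b` in its
  -- maximal ideal.
  obtain ⟨V, hAV, hIV⟩ := Ideal.image_subset_nonunits_valuationSubring _ hI
  have hbV : b ∈ V := hAV hbA
  have hbm : (⟨b, hbV⟩ : V) ∈ IsLocalRing.maximalIdeal V := by
    have : b ∈ (V.nonunits : Set k) := hIV ⟨_, Ideal.mem_span_singleton_self _, rfl⟩
    rw [← V.image_maximalIdeal] at this
    obtain ⟨c, hc, hcb⟩ := this
    have : c = ⟨b, hbV⟩ := Subtype.ext hcb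
    rwa [← this]
  let B : Subalgebra F k :=
    { V.toSubring with algebraMap_mem' := fun c => hAV (A.algebraMap_mem c) }
  have hFB : ∀ c : F, algebraMap F k c ∈ V := fun c => hAV (A.algebraMap_mem c)
  -- A nonzero `x ∈ I` is either a constant, hence a unit, or transcendental. In the latter case `B
  -- / xB` is finite-dimensional, so `I` is generated by `x` and finitely many further elements.
  have hnoethB : IsNoetherianRing B := by
    refine isNoetherianRing_iff_ideal_fg B |>.2 fun I => ?_
    rcases eq_or_ne I ⊥ with rfl | hI
    · exact Submodule.fg_bot
    obtain ⟨x, hxI, hx0⟩ := Submodule.exists_mem_ne_zero_of_ne_bot hI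
    by_cases hx : IsAlgebraic F (x : k)
    · obtain ⟨c, hc⟩ := IsGlobalFunctionField.full_constants _ hx
      have hcx : algebraMap F B c = x := Subtype.ext hc
      have : I = ⊤ := Ideal.eq_top_of_isUnit_mem _ hxI (by
        rw [← hcx]
        refine (IsUnit.mk0 c ?_).map (algebraMap F B)
        rintro rfl
        exact hx0 (by rw [← hcx, map_zero]))
      rw [this]
      exact Ideal.fg_top B
    · have := finiteDimensional_adjoin_of_transcendental F hx
      have hfin := finite_quotient_of_mem (F := F) (b := (x : k)) (fun h => hx0 (Subtype.ext h)) B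
        x.2 (Ideal.span {x}) (Ideal.mem_span_singleton_self x)
      have hno : IsNoetherian B (B ⧸ Ideal.span {x}) := isNoetherian_of_tower F inferInstance
      refine Submodule.fg_of_fg_map_of_fg_inf_ker (Submodule.mkQ (Ideal.span {x}))
        (IsNoetherian.noetherian _) ?_
      rw [Submodule.ker_mkQ, inf_eq_right.2 ((Ideal.span_singleton_le_iff_mem I).2 hxI)]
      exact ⟨{x}, by simp⟩
  have hnoeth : IsNoetherianRing V :=
    isNoetherianRing_of_ringEquiv B
      { toFun := fun x => ⟨x, x.2⟩, invFun := fun x => ⟨x, x.2⟩, left_inv := fun _ => rfl,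
        right_inv := fun _ => rfl, map_mul' := fun _ _ => rfl, map_add' := fun _ _ => rfl }
  have hnf : ¬ IsField V := by
    intro hf
    rw [IsLocalRing.isField_iff_maximalIdeal_eq] at hf
    rw [hf, Ideal.mem_bot] at hbm
    exact hb0 (congrArg Subtype.val hbm)
  have hdvr : IsDiscreteValuationRing V :=
    ((IsDiscreteValuationRing.TFAE V hnf).out 0 1).2
      (inferInstance : ValuationRing V)
  let w := (IsDiscreteValuationRing.maximalIdeal V).valuation k
  have hw : ∀ x : V, w x ≤ 1 := fun x => IsDedekindDomain.HeightOneSpectrum.valuation_le_one _ x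
  have hwb : w b < 1 :=
    (IsDedekindDomain.HeightOneSpectrum.valuation_lt_one_iff_mem
      (K := k) (IsDiscreteValuationRing.maximalIdeal V) ⟨b, hbV⟩).2 hbm
  exact ⟨⟨w, IsDedekindDomain.HeightOneSpectrum.valuation_surjective k _,
    fun c => hw ⟨_, hFB c⟩, finite_quotient_of_mem hb0 _ hwb.le _ hwb⟩, hwb⟩

end ExistencePlaces

/-! ### Dimension counts in `A` and the Liouville inequality. -/

section AffineRing

variable {Fr : Type*} [Field Fr] {k : Type*} [Field k] [Algebra Fr k]

theorem Place.val_algebraMap (P : Place Fr k) {c : Fr} (hc : c ≠ 0) :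
    P.val (algebraMap Fr k c) = 1 := by
  refine le_antisymm (P.le_one c) ?_
  have h := P.le_one c⁻¹
  rw [map_inv₀, map_inv₀] at h
  have h0 : P.val (algebraMap Fr k c) ≠ 0 := P.val.ne_zero_iff.2 (by simpa using hc)
  exact (inv_le_one₀ (zero_lt_iff.2 h0)).1 h

theorem val_le_one_of_mem_affineRing {inf : Place Fr k} {a : k} (ha : a ∈ affineRing inf)
    {P : Place Fr k} (hP : P ≠ inf) : P.val a ≤ 1 := by
  have h : affineRing inf ≤ P.ring := iInf₂_le P hP
  exact h ha

/-- A nonzero function that is regular away from `∞` cannot vanish at `∞`. -/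
theorem one_le_val_of_mem_affineRing [IsGlobalFunctionField Fr k] {inf : Place Fr k} {a : k}
    (ha : a ∈ affineRing inf) (ha0 : a ≠ 0) : 1 ≤ inf.val a := by
  by_contra! hlt
  have htr : Transcendental Fr a := by
    intro halg
    obtain ⟨c, rfl⟩ := IsGlobalFunctionField.full_constants a halg
    refine hlt.ne (inf.val_algebraMap ?_)
    rintro rfl
    exact ha0 (map_zero _)
  have htr' : Transcendental Fr a⁻¹ := fun h => htr (IsAlgebraic.inv_iff.1 h)
  -- A zero of `a⁻¹` is a pole of `a`; it is not `∞`, where `a` vanishes, contradicting regularity.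
  obtain ⟨P, hP⟩ := exists_place_lt_one htr'
  rw [map_inv₀, inv_lt_one₀ (zero_lt_iff.2 (P.val.ne_zero_iff.2 ha0))] at hP
  refine (val_le_one_of_mem_affineRing ha (P := P) ?_).not_gt hP
  rintro rfl
  exact hlt.not_gt hP

/-- The functions regular away from `∞` whose pole order at `∞` is less than `m`. -/
def poleLT (inf : Place Fr k) (m : ℕ) : Submodule Fr k where
  carrier := {x | x ∈ affineRing inf ∧ inf.val x < WithZero.exp (m : ℤ)}
  zero_mem' := ⟨zero_mem _, by simp⟩
  add_mem' ha hb := ⟨add_mem ha.1 hb.1, inf.val.map_add_lt ha.2 hb.2⟩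
  smul_mem' c x hx := ⟨Subalgebra.smul_mem _ hx.1 c, by
    rw [Algebra.smul_def, map_mul]
    exact (mul_le_of_le_one_left' (inf.le_one c)).trans_lt hx.2⟩

theorem lt_exp_add_one_iff {x : ℤᵐ⁰} {m : ℤ} : x < WithZero.exp (m + 1) ↔ x ≤ WithZero.exp m := by
  rcases eq_or_ne x 0 with rfl | hx
  · simp
  · rw [← WithZero.exp_log hx, WithZero.exp_lt_exp, WithZero.exp_le_exp, Int.lt_add_one_iff]

/-- Raising the allowed pole order by one costs at most `deg ∞` dimensions: after multiplication by
`u` of order `m`, reduction to the residue field has kernel inside `poleLT inf m`. The induction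
starts from zero because a nonzero element of `A` cannot vanish at `∞`. -/
theorem rank_poleLT_le [IsGlobalFunctionField Fr k] (inf : Place Fr k) (m : ℕ) :
    Module.rank Fr (poleLT inf m) ≤ ((m * inf.deg : ℕ) : Cardinal) := by
  induction m with
  | zero =>
    have : poleLT inf 0 = ⊥ := by
      refine (Submodule.eq_bot_iff _).2 fun x hx => ?_
      by_contra hx0
      exact (one_le_val_of_mem_affineRing hx.1 hx0).not_gt (by simpa using hx.2)
    rw [this, rank_bot]
    exact zero_le
  | succ m ih =>
    obtain ⟨u, hu⟩ := inf.surj (WithZero.exp (-(m : ℤ)))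
    have hmem : ∀ x : poleLT inf (m + 1), inf.val (u * x) ≤ 1 := fun x => by
      have h := x.2.2
      push_cast at h
      rw [lt_exp_add_one_iff] at h
      rw [map_mul, hu]
      calc WithZero.exp (-(m : ℤ)) * inf.val x
          ≤ WithZero.exp (-(m : ℤ)) * WithZero.exp (m : ℤ) := by gcongr
        _ = 1 := by rw [← WithZero.exp_add, neg_add_cancel, WithZero.exp_zero]
    let g : poleLT inf (m + 1) →ₗ[Fr] valuationRing inf.val inf.le_one :=
      { toFun := fun x => ⟨u * x, hmem x⟩
        map_add' := fun x y => Subtype.ext (mul_add _ _ _)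
        map_smul' := fun c x => Subtype.ext (mul_smul_comm c u (x : k)) }
    let f : poleLT inf (m + 1) →ₗ[Fr]
        valuationRing inf.val inf.le_one ⧸ valuationIdeal inf.val inf.le_one :=
      (Ideal.Quotient.mkₐ Fr (valuationIdeal inf.val inf.le_one)).toLinearMap ∘ₗ g
    have hker : ∀ x : LinearMap.ker f, ((x : poleLT inf (m + 1)) : k) ∈ poleLT inf m := fun x => by
      have h0 : Ideal.Quotient.mk (valuationIdeal inf.val inf.le_one) (g x) = 0 := x.2
      have h1 : inf.val (u * ((x : poleLT inf (m + 1)) : k)) < 1 := Ideal.Quotient.eq_zero_iff_mem.1 h0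
      refine ⟨x.1.2.1, ?_⟩
      rw [map_mul, hu, WithZero.exp_neg, inv_mul_lt_iff₀ (by simp), mul_one] at h1
      exact h1
    let e : LinearMap.ker f →ₗ[Fr] poleLT inf m :=
      LinearMap.codRestrict _ ((poleLT inf (m + 1)).subtype ∘ₗ (LinearMap.ker f).subtype) hker
    have he : Function.Injective e := fun x y hxy =>
      Subtype.ext (Subtype.ext (congrArg (fun z : poleLT inf m => (z : k)) hxy))
    have hfin := inf.finite_residue
    have h1 : Module.rank Fr (LinearMap.range f) ≤ (inf.deg : Cardinal) := by
      refine (Submodule.rank_le _).trans ?_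
      rw [Place.deg, Module.finrank_eq_rank]
    have h2 := (LinearMap.rank_le_of_injective e he).trans ih
    rw [← LinearMap.rank_range_add_rank_ker f]
    refine (add_le_add h1 h2).trans ?_
    rw [← Nat.cast_add, Nat.cast_le]
    exact le_of_eq (by ring)

theorem exists_val_eq_exp_natCast [IsGlobalFunctionField Fr k] {inf : Place Fr k} {a : k}
    (ha : a ∈ affineRing inf) (ha0 : a ≠ 0) :
    ∃ n : ℕ, inf.val a = WithZero.exp (n : ℤ) := by
  have h1 := one_le_val_of_mem_affineRing ha ha0
  have h0 : inf.val a ≠ 0 := inf.val.ne_zero_iff.2 ha0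
  rw [← WithZero.exp_log h0, ← WithZero.exp_zero, WithZero.exp_le_exp] at h1
  exact ⟨(WithZero.log (inf.val a)).toNat, by rw [Int.toNat_of_nonneg h1, WithZero.exp_log h0]⟩

/-- Uniqueness of `a`-adic expansions: reduction modulo `a` kills the lowest digit, then `a` is
cancelled. -/
theorem coeff_eq_zero_of_sum_pow_mul {ι : Type*} [Fintype ι] {inf : Place Fr k}
    {a : affineRing inf} (ha0 : a ≠ 0) (x : ι → affineRing inf)
    (hx : LinearIndependent Fr fun i => Ideal.Quotient.mk (Ideal.span {a}) (x i))
    (L : ℕ) (c : ℕ → ι → Fr)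
    (h : ∑ l ∈ Finset.range L, a ^ l * ∑ i, c l i • x i = 0) : ∀ l < L, ∀ i, c l i = 0 := by
  induction L generalizing c with
  | zero => intro l hl; omega
  | succ L ih =>
    rw [Finset.sum_range_succ', pow_zero, one_mul] at h
    have hfac : ∑ l ∈ Finset.range L, a ^ (l + 1) * ∑ i, c (l + 1) i • x i =
        a * ∑ l ∈ Finset.range L, a ^ l * ∑ i, c (l + 1) i • x i := by
      rw [Finset.mul_sum]
      exact Finset.sum_congr rfl fun l _ => by ring
    rw [hfac] at h
    have h0 : ∀ i, c 0 i = 0 := by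
      refine Fintype.linearIndependent_iff.1 hx _ ?_
      have h1 : ∑ i, c 0 i • x i ∈ Ideal.span {a} := by
        rw [eq_neg_of_add_eq_zero_right h]
        exact neg_mem (Ideal.mul_mem_right _ _ (Ideal.mem_span_singleton_self a))
      rw [← Ideal.Quotient.eq_zero_iff_mem] at h1
      rw [← h1, map_sum]
      rfl
    simp only [h0, zero_smul, Finset.sum_const_zero, add_zero] at h
    have h2 := ih (fun l => c (l + 1)) ((mul_eq_zero.1 h).resolve_left ha0)
    intro l hl i
    rcases l with _ | l
    · exact h0 i
    · exact h2 l (by omega) i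

/-- The dimension of `A / aA` is at most the degree of the polar divisor of `a`. -/
theorem card_le_of_linearIndependent_quotient [IsGlobalFunctionField Fr k] {ι : Type*} [Fintype ι]
    {inf : Place Fr k} {a : affineRing inf} (ha0 : a ≠ 0) {n : ℕ}
    (hn : inf.val (a : k) = WithZero.exp (n : ℤ)) (x : ι → affineRing inf)
    (hx : LinearIndependent Fr fun i => Ideal.Quotient.mk (Ideal.span {a}) (x i)) :
    Fintype.card ι ≤ n * inf.deg := by
  obtain ⟨M, hM⟩ : ∃ M : ℕ, ∀ i, inf.val (x i : k) < WithZero.exp (M : ℤ) := by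
    have h1 : ∀ i, ∃ M : ℕ, inf.val (x i : k) < WithZero.exp (M : ℤ) := fun i => by
      by_cases h0 : (x i : k) = 0
      · exact ⟨0, by simp [h0]⟩
      · obtain ⟨m, hm⟩ := exists_val_eq_exp_natCast (x i).2 h0
        exact ⟨m + 1, by rw [hm, WithZero.exp_lt_exp]; push_cast; omega⟩
    choose m hm using h1
    refine ⟨∑ i, m i, fun i => (hm i).trans_le ?_⟩
    rw [WithZero.exp_le_exp]
    exact_mod_cast Finset.single_le_sum (f := m) (fun _ _ => Nat.zero_le _) (Finset.mem_univ i)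
  -- The `L * card ι` elements `a ^ l * x i` with `l < L` are independent and have pole order below
  -- `M + n * L`.
  have key : ∀ L : ℕ, L * Fintype.card ι ≤ (M + n * L) * inf.deg := by
    intro L
    have hmem : ∀ q : Fin L × ι, ((a : k) ^ (q.1 : ℕ) * (x q.2 : k)) ∈ poleLT inf (M + n * L) := by
      intro q
      refine ⟨mul_mem (pow_mem a.2 _) (x q.2).2, ?_⟩
      rw [map_mul, map_pow, hn, ← WithZero.exp_nsmul]
      calc WithZero.exp ((q.1 : ℕ) • (n : ℤ)) * inf.val (x q.2 : k)
          < WithZero.exp ((q.1 : ℕ) • (n : ℤ)) * WithZero.exp (M : ℤ) := by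
            gcongr
            · simp
            · exact hM q.2
        _ ≤ WithZero.exp (((M + n * L : ℕ)) : ℤ) := by
            rw [← WithZero.exp_add, WithZero.exp_le_exp]
            have h1 : (q.1 : ℕ) * n ≤ L * n := Nat.mul_le_mul_right n q.1.2.le
            simp only [nsmul_eq_mul]
            push_cast
            have : ((q.1 : ℕ) : ℤ) * n ≤ L * n := by exact_mod_cast h1
            linarith
    have hli : LinearIndependent Fr fun q : Fin L × ι =>
        (⟨_, hmem q⟩ : poleLT inf (M + n * L)) := by
      rw [Fintype.linearIndependent_iff]
      intro c hc
      have hc' : ∑ q : Fin L × ι, c q • (a ^ (q.1 : ℕ) * x q.2) = 0 := by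
        apply Subtype.ext
        have := congrArg (fun z : poleLT inf (M + n * L) => (z : k)) hc
        push_cast at this ⊢
        exact this
      rw [Fintype.sum_prod_type] at hc'
      let c' : ℕ → ι → Fr := fun l i => if hl : l < L then c (⟨l, hl⟩, i) else 0
      have h := coeff_eq_zero_of_sum_pow_mul ha0 x hx L c' (by
        rw [← hc', Finset.sum_range]
        refine Finset.sum_congr rfl fun l _ => ?_
        rw [Finset.mul_sum]
        refine Finset.sum_congr rfl fun i _ => ?_
        simp only [c', l.2, dif_pos, Fin.eta, mul_smul_comm])
      rintro ⟨l, i⟩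
      simpa [c'] using h l l.2 i
    have h1 := hli.cardinal_lift_le_rank.trans
      (Cardinal.lift_le.2 (rank_poleLT_le inf (M + n * L)))
    rw [Cardinal.mk_fintype, Cardinal.lift_natCast, Cardinal.lift_natCast, Nat.cast_le,
      Fintype.card_prod, Fintype.card_fin] at h1
    exact h1
  by_contra! hcon
  -- If `card ι` exceeded `n * inf.deg`, `key L` would give `L ≤ M * inf.deg`.
  have h := key (M * inf.deg + 1)
  nlinarith [Nat.mul_le_mul_left (M * inf.deg + 1) (Nat.succ_le_of_lt hcon)]

theorem finite_quotient_span_singleton [IsGlobalFunctionField Fr k] {inf : Place Fr k}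
    {a : affineRing inf} (ha0 : a ≠ 0) : Module.Finite Fr (affineRing inf ⧸ Ideal.span {a}) := by
  obtain ⟨n, hn⟩ := exists_val_eq_exp_natCast a.2 (fun h => ha0 (Subtype.ext h))
  have : Module.Free Fr (affineRing inf ⧸ Ideal.span {a}) := Module.Free.of_divisionRing _ _
  refine Module.rank_lt_aleph0_iff.1 (lt_of_le_of_lt (rank_le (n := n * inf.deg) ?_)
    (Cardinal.natCast_lt_aleph0))
  intro s hs
  choose y hy using fun i : s => Ideal.Quotient.mk_surjective (i : affineRing inf ⧸ Ideal.span {a})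
  have := card_le_of_linearIndependent_quotient ha0 hn y (by simpa only [hy] using hs)
  rwa [Fintype.card_coe] at this

/-- The zero order at a place `v ≠ ∞` of a function regular away from `∞` is bounded by a
multiple of its pole order at `∞`. -/
theorem exists_zero_order_le [IsGlobalFunctionField Fr k] {inf v : Place Fr k} (hv : v ≠ inf) :
    ∃ e : ℕ, ∀ a ∈ affineRing inf, a ≠ 0 → ∃ n m : ℕ, inf.val a = WithZero.exp (n : ℤ) ∧
      v.val a = WithZero.exp (-(m : ℤ)) ∧ m ≤ e * n := by
  have hord : ∀ a ∈ affineRing inf, a ≠ 0 → ∃ m : ℕ, v.val a = WithZero.exp (-(m : ℤ)) := by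
    intro a ha ha0
    have h1 := val_le_one_of_mem_affineRing ha hv
    have h0 : v.val a ≠ 0 := v.val.ne_zero_iff.2 ha0
    rw [← WithZero.exp_log h0, ← WithZero.exp_zero, WithZero.exp_le_exp] at h1
    exact ⟨(-WithZero.log (v.val a)).toNat, by
      rw [Int.toNat_of_nonneg (by omega), neg_neg, WithZero.exp_log h0]⟩
  by_cases hT : ∃ T ∈ affineRing inf, T ≠ 0 ∧ v.val T ≠ 1
  swap
  · push Not at hT
    refine ⟨0, fun a ha ha0 => ?_⟩
    obtain ⟨n, hn⟩ := exists_val_eq_exp_natCast ha ha0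
    exact ⟨n, 0, hn, by simpa using hT a ha ha0, by simp⟩
  obtain ⟨T, hTA, hT0, hT1⟩ := hT
  obtain ⟨e, he⟩ := hord T hTA hT0
  have he0 : 0 < e := by
    rcases Nat.eq_zero_or_pos e with rfl | h
    · simp [he] at hT1
    · exact h
  refine ⟨e * inf.deg, fun a ha ha0 => ?_⟩
  obtain ⟨n, hn⟩ := exists_val_eq_exp_natCast ha ha0
  obtain ⟨m, hm⟩ := hord a ha ha0
  refine ⟨n, m, hn, hm, ?_⟩
  by_contra! hcon
  -- If `m > e * inf.deg * n`, a combination of the powers `T ^ i`, `i ≤ n * inf.deg`, divisible by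
  -- `a` has `v`-order at least `m`, above that of each nonzero term. The terms have distinct orders
  -- `e * i`, so the lowest nonzero one could not cancel. This gives one independent element too
  -- many in `A / aA`.
  have hli : LinearIndependent Fr fun i : Fin (n * inf.deg + 1) =>
      Ideal.Quotient.mk (Ideal.span {(⟨a, ha⟩ : affineRing inf)})
        ((⟨T, hTA⟩ : affineRing inf) ^ (i : ℕ)) := by
    rw [Fintype.linearIndependent_iff]
    intro c hc
    have hmem : ∑ i, c i • (⟨T, hTA⟩ : affineRing inf) ^ (i : ℕ) ∈
        Ideal.span {(⟨a, ha⟩ : affineRing inf)} := by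
      rw [← Ideal.Quotient.eq_zero_iff_mem, map_sum]
      exact hc
    obtain ⟨z, hz⟩ := Ideal.mem_span_singleton.1 hmem
    have hz' : ∑ i, algebraMap Fr k (c i) * T ^ (i : ℕ) = a * z := by
      have := congrArg Subtype.val hz
      push_cast at this
      rw [← this]
      exact Finset.sum_congr rfl fun i _ => (Algebra.smul_def _ _).symm
    have hterm : ∀ i, v.val (algebraMap Fr k (c i) * T ^ (i : ℕ)) ≤
        WithZero.exp (-((e * i : ℕ) : ℤ)) := fun i => by
      rw [map_mul, map_pow, he, ← WithZero.exp_nsmul]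
      refine (mul_le_of_le_one_left' (v.le_one _)).trans (le_of_eq ?_)
      congr 1
      simp only [nsmul_eq_mul]
      push_cast
      ring
    intro i
    induction hi : (i : ℕ) using Nat.strong_induction_on generalizing i with
    | _ j ih =>
    subst hi
    by_contra hci
    have hval : v.val (algebraMap Fr k (c i) * T ^ (i : ℕ)) = WithZero.exp (-((e * i : ℕ) : ℤ)) := by
      rw [map_mul, map_pow, he, ← WithZero.exp_nsmul, v.val_algebraMap hci, one_mul]
      congr 1
      simp only [nsmul_eq_mul]
      push_cast
      ring
    rw [← Finset.add_sum_erase _ _ (Finset.mem_univ i)] at hz'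
    have hlt : v.val (a * z - ∑ l ∈ Finset.univ.erase i, algebraMap Fr k (c l) * T ^ (l : ℕ)) <
        WithZero.exp (-((e * i : ℕ) : ℤ)) := by
      refine v.val.map_sub_lt ?_ (v.val.map_sum_lt WithZero.exp_ne_zero fun l hl => ?_)
      · rw [map_mul, hm]
        refine (mul_le_of_le_one_right' (val_le_one_of_mem_affineRing z.2 hv)).trans_lt ?_
        rw [WithZero.exp_lt_exp, neg_lt_neg_iff, Nat.cast_lt]
        have : e * (i : ℕ) ≤ e * (n * inf.deg) := Nat.mul_le_mul_left e (by omega)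
        nlinarith
      · rcases lt_trichotomy (l : ℕ) i with h | h | h
        · rw [ih l h l rfl, map_zero, zero_mul, map_zero]
          simp
        · exact absurd (Fin.ext h) (Finset.ne_of_mem_erase hl)
        · refine (hterm l).trans_lt ?_
          rw [WithZero.exp_lt_exp, neg_lt_neg_iff, Nat.cast_lt]
          exact Nat.mul_lt_mul_of_pos_left h he0
    rw [← hz', add_sub_cancel_right, hval] at hlt
    exact lt_irrefl _ hlt
  have := card_le_of_linearIndependent_quotient (fun h => ha0 (congrArg Subtype.val h)) hn _ hli
  simp at this

theorem one_le_abv_inf [Finite Fr] [IsGlobalFunctionField Fr k] {inf : Place Fr k} {a : k}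
    (ha : a ∈ affineRing inf) (ha0 : a ≠ 0) : 1 ≤ inf.abv a := by
  have := (inf.abv_le_abv_iff 1 a).2 (by simpa using one_le_val_of_mem_affineRing ha ha0)
  simpa using this

theorem Place.abv_eq_zpow [Finite Fr] (P : Place Fr k) {a : k} {n : ℤ}
    (h : P.val a = WithZero.exp n) : P.abv a = (P.q : ℝ) ^ n := by
  rw [P.abv_apply, h]
  simp [WithZeroMulInt.toNNReal]
  rfl

/-- A Liouville inequality for functions regular away from `∞`. -/
theorem exists_one_le_abv_mul_abv_pow [Finite Fr] [IsGlobalFunctionField Fr k]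
    (inf v : Place Fr k) :
    ∃ e : ℕ, ∀ a ∈ affineRing inf, a ≠ 0 → 1 ≤ v.abv a * inf.abv a ^ e := by
  rcases eq_or_ne v inf with rfl | hv
  · exact ⟨0, fun a ha ha0 => by simpa using one_le_abv_inf ha ha0⟩
  obtain ⟨e, he⟩ := exists_zero_order_le hv
  have hq : (1 : ℝ) < inf.q := by exact_mod_cast inf.one_lt_q
  have hqv : (1 : ℝ) < v.q := by exact_mod_cast v.one_lt_q
  -- The exponent `s` converts powers of `q_v` into powers of `q_∞`.
  obtain ⟨s, hs⟩ := pow_unbounded_of_one_lt (v.q : ℝ) hq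
  refine ⟨s * e, fun a ha ha0 => ?_⟩
  obtain ⟨n, m, hn, hm, hmn⟩ := he a ha ha0
  rw [inf.abv_eq_zpow hn, v.abv_eq_zpow hm, zpow_neg, zpow_natCast, zpow_natCast, ← pow_mul]
  rw [inv_mul_eq_div, one_le_div (by positivity)]
  calc (v.q : ℝ) ^ m ≤ (v.q : ℝ) ^ (e * n) := pow_le_pow_right₀ hqv.le hmn
    _ ≤ ((inf.q : ℝ) ^ s) ^ (e * n) := by gcongr
    _ = (inf.q : ℝ) ^ (n * (s * e)) := by rw [← pow_mul]; congr 1; ring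

end AffineRing

/-! ### Finiteness of the set of ideals of given degree. -/

section FinitelyManyIdeals

variable {Fr : Type*} [Field Fr] {k : Type*} [Field k] [Algebra Fr k]
  [IsGlobalFunctionField Fr k] {inf : Place Fr k}

theorem finite_quotient_of_ne_bot {I : Ideal (affineRing inf)} (hI : I ≠ ⊥) :
    Module.Finite Fr (affineRing inf ⧸ I) := by
  obtain ⟨a, haI, ha0⟩ := Submodule.exists_mem_ne_zero_of_ne_bot hI
  have := finite_quotient_span_singleton ha0
  have hle : Ideal.span {a} ≤ I := (Ideal.span_singleton_le_iff_mem I).2 haI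
  exact Module.Finite.of_surjective (Ideal.Quotient.factorₐ Fr hle).toLinearMap
    (Ideal.Quotient.factor_surjective hle)

theorem finite_ideals_containing [Finite Fr] {g : affineRing inf} (hg : g ≠ 0) :
    {I : Ideal (affineRing inf) | g ∈ I}.Finite := by
  have := finite_quotient_span_singleton hg
  have : Finite (affineRing inf ⧸ Ideal.span {g}) := Module.finite_of_finite Fr
  have : Finite (Ideal (affineRing inf ⧸ Ideal.span {g})) :=
    Finite.of_injective _ SetLike.coe_injective
  refine (Set.finite_range (Ideal.comap (Ideal.Quotient.mk (Ideal.span {g})))).subset ?_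
  intro I hI
  exact ⟨I.map (Ideal.Quotient.mk _),
    Ideal.comap_map_mk ((Ideal.span_singleton_le_iff_mem I).2 hI)⟩

-- By Cayley–Hamilton, `I` contains `f(T)` for the characteristic polynomial `f` of `T` on `A / I`.
-- There are finitely many such `f` of degree `d`, and each nonzero `f(T)` lies in finitely many
-- ideals. Without a transcendental `T`, the ring `A` is the constant field.
open Polynomial in
theorem finite_setOf_idealDeg_eq [Finite Fr] (d : ℕ) :
    {I : NzIdeal inf | idealDeg I = d}.Finite := by
  refine Set.Finite.of_finite_image (f := Subtype.val) ?_ Subtype.val_injective.injOn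
  by_cases hT : ∃ T : affineRing inf, Transcendental Fr T
  · obtain ⟨T, hT⟩ := hT
    have hpoly : (degreeLT Fr (d + 1) : Set Fr[X]).Finite := by
      have : Module.Finite Fr (degreeLT Fr (d + 1)) :=
        Module.Finite.equiv (degreeLTEquiv Fr (d + 1)).symm
      have : Finite (degreeLT Fr (d + 1)) := Module.finite_of_finite Fr
      exact Set.toFinite _
    refine ((hpoly.subset Set.sdiff_subset :
      {f ∈ (degreeLT Fr (d + 1) : Set Fr[X]) | f ≠ 0}.Finite).biUnion
      fun f hf => finite_ideals_containing (inf := inf) (g := aeval T f) ?_).subset ?_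
    · exact fun h => hT ⟨f, hf.2, h⟩
    · rintro _ ⟨I, hI, rfl⟩
      have hfin := finite_quotient_of_ne_bot (nonZeroDivisors.ne_zero I.2)
      have : Module.Free Fr (affineRing inf ⧸ (I : Ideal (affineRing inf))) :=
        Module.Free.of_divisionRing _ _
      let φ : Module.End Fr (affineRing inf ⧸ (I : Ideal (affineRing inf))) :=
        Algebra.lmul Fr _ (Ideal.Quotient.mkₐ Fr _ T)
      refine Set.mem_biUnion (x := φ.charpoly) ⟨?_, φ.charpoly_monic.ne_zero⟩ ?_
      · rw [SetLike.mem_coe, mem_degreeLT]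
        refine degree_le_natDegree.trans_lt ?_
        rw [LinearMap.charpoly_natDegree]
        exact_mod_cast Nat.lt_succ_of_le (le_of_eq hI)
      · have h := LinearMap.congr_fun φ.aeval_self_charpoly 1
        rw [Polynomial.aeval_algHom_apply, Polynomial.aeval_algHom_apply, Algebra.coe_lmul_eq_mul,
          LinearMap.mul_apply', mul_one] at h
        exact Ideal.Quotient.eq_zero_iff_mem.1 h
  · push Not at hT
    refine (Set.finite_singleton (⊤ : Ideal (affineRing inf))).subset ?_
    rintro _ ⟨I, _, rfl⟩
    obtain ⟨a, haI, ha0⟩ := Submodule.exists_mem_ne_zero_of_ne_bot (nonZeroDivisors.ne_zero I.2)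
    obtain ⟨c, hc⟩ := IsGlobalFunctionField.full_constants (a : k)
      ((not_not.1 (hT a)).algHom (affineRing inf).val)
    have hca : algebraMap Fr (affineRing inf) c = a := Subtype.ext hc
    refine Ideal.eq_top_of_isUnit_mem _ haI ?_
    rw [← hca]
    refine (IsUnit.mk0 c ?_).map (algebraMap Fr (affineRing inf))
    rintro rfl
    exact ha0 (by rw [← hca, map_zero])

theorem tendsto_idealDeg_cofinite [Finite Fr] :
    Filter.Tendsto (idealDeg (inf := inf)) Filter.cofinite Filter.atTop := by
  rw [← Nat.cofinite_eq_atTop]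
  exact Filter.Tendsto.cofinite_of_finite_preimage_singleton finite_setOf_idealDeg_eq

end FinitelyManyIdeals

/-! ### Vanishing and bounded power sums. -/

section PowerSums

variable {C : Type*} [NormedField C] {ι : Type*}

theorem sum_mul_eval_eq_zero (S : Finset ι) (β z : ι → C) (N : ℕ)
    (h : ∀ j ≤ N, ∑ i ∈ S, β i * z i ^ j = 0) (P : Polynomial C) (hP : P.natDegree ≤ N) :
    ∑ i ∈ S, β i * P.eval (z i) = 0 := by
  simp_rw [Polynomial.eval_eq_sum_range' (Nat.lt_succ_of_le hP), Finset.mul_sum]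
  rw [Finset.sum_comm]
  refine Finset.sum_eq_zero fun j hj => ?_
  have := h j (Nat.lt_succ_iff.1 (Finset.mem_range.1 hj))
  rw [← mul_zero (P.coeff j), ← this, Finset.mul_sum]
  exact Finset.sum_congr rfl fun i _ => by ring

/-- If the power sums `∑ β_i z_i ^ j` are bounded in `j`, then the total weight of every value
`w` with `1 < ‖w‖` vanishes. -/
theorem sum_filter_eq_zero_of_bounded [DecidableEq C] (S : Finset ι) (β z : ι → C) (B : ℝ)
    (h : ∀ j : ℕ, ‖∑ i ∈ S, β i * z i ^ j‖ ≤ B) (w : C) (hw : 1 < ‖w‖) :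
    ∑ i ∈ S with z i = w, β i = 0 := by
  -- `H` kills every value other than `w`, so weighting by `H(z_i) z_i ^ j` leaves the total weight
  -- at `w` times `H(w) w ^ j`. This stays bounded in `j` only if the weight is zero.
  let H : Polynomial C := ∏ u ∈ (S.image z).erase w, (Polynomial.X - Polynomial.C u)
  have hHw : H.eval w ≠ 0 := by
    simp only [H, Polynomial.eval_prod, Polynomial.eval_sub, Polynomial.eval_X, Polynomial.eval_C]
    exact Finset.prod_ne_zero_iff.2 fun u hu => sub_ne_zero.2 (Finset.ne_of_mem_erase hu).symm
  have hH0 : ∀ i ∈ S, z i ≠ w → H.eval (z i) = 0 := fun i hi hne => by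
    simp only [H, Polynomial.eval_prod, Polynomial.eval_sub, Polynomial.eval_X, Polynomial.eval_C]
    exact Finset.prod_eq_zero (Finset.mem_erase.2 ⟨hne, Finset.mem_image_of_mem z hi⟩) (sub_self _)
  have hsum : ∀ j : ℕ, ∑ i ∈ S, β i * (H.eval (z i) * z i ^ j) =
      (∑ i ∈ S with z i = w, β i) * H.eval w * w ^ j := fun j => by
    rw [Finset.sum_mul, Finset.sum_mul, Finset.sum_filter]
    refine Finset.sum_congr rfl fun i hi => ?_
    split_ifs with hzi
    · rw [hzi]; ring
    · rw [hH0 i hi hzi]; ring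
  have hbound : ∀ j : ℕ, ‖(∑ i ∈ S with z i = w, β i) * H.eval w * w ^ j‖ ≤
      ∑ l ∈ Finset.range (H.natDegree + 1), ‖H.coeff l‖ * B := fun j => by
    have : ∑ i ∈ S, β i * (H.eval (z i) * z i ^ j) =
        ∑ l ∈ Finset.range (H.natDegree + 1), H.coeff l * ∑ i ∈ S, β i * z i ^ (j + l) := by
      simp_rw [Polynomial.eval_eq_sum_range, Finset.sum_mul, Finset.mul_sum]
      rw [Finset.sum_comm]
      exact Finset.sum_congr rfl fun l _ => Finset.sum_congr rfl fun i _ => by ring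
    rw [← hsum, this]
    refine (norm_sum_le _ _).trans (Finset.sum_le_sum fun l _ => ?_)
    rw [norm_mul]
    exact mul_le_mul_of_nonneg_left (h _) (norm_nonneg _)
  by_contra hne
  have hpos : 0 < ‖(∑ i ∈ S with z i = w, β i) * H.eval w‖ := norm_pos_iff.2 (mul_ne_zero hne hHw)
  obtain ⟨j, hj⟩ := pow_unbounded_of_one_lt
    ((∑ l ∈ Finset.range (H.natDegree + 1), ‖H.coeff l‖ * B) /
      ‖(∑ i ∈ S with z i = w, β i) * H.eval w‖) hw
  rw [div_lt_iff₀ hpos] at hj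
  have := hbound j
  rw [norm_mul _ (w ^ j), norm_pow] at this
  linarith

-- Values outside the unit ball are grouped into fibres, each of total weight zero.
open Classical in
theorem sum_filter_one_lt_norm_eq_zero (S : Finset ι) (β z : ι → C) (B : ℝ)
    (h : ∀ j : ℕ, ‖∑ i ∈ S, β i * z i ^ j‖ ≤ B) (G : C → C) :
    ∑ i ∈ S with 1 < ‖z i‖, β i * G (z i) = 0 := by
  rw [← Finset.sum_fiberwise_of_maps_to (t := (S.filter fun i => 1 < ‖z i‖).image z) (g := z)
    fun i hi => Finset.mem_image_of_mem z hi]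
  refine Finset.sum_eq_zero fun w hw => ?_
  obtain ⟨i₀, hi₀, rfl⟩ := Finset.mem_image.1 hw
  have hw1 := (Finset.mem_filter.1 hi₀).2
  rw [Finset.filter_filter]
  calc ∑ i ∈ S with 1 < ‖z i‖ ∧ z i = z i₀, β i * G (z i)
      = ∑ i ∈ S with z i = z i₀, β i * G (z i₀) := by
        refine Finset.sum_congr (Finset.filter_congr fun i _ => ⟨And.right, fun h => ?_⟩)
          fun i hi => by rw [(Finset.mem_filter.1 hi).2]
        exact ⟨by rw [h]; exact hw1, h⟩
    _ = 0 := by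
        rw [← Finset.sum_mul, sum_filter_eq_zero_of_bounded S β z B h _ hw1, zero_mul]

end PowerSums

/-! ### Growth estimates. -/

section Growth

/-- A sequence of logarithmic growth is linear in `m` on the ranges `j ≤ B * p ^ m`. -/
theorem exists_lt_mul_of_isBigO_log {N : ℕ → ℕ}
    (hN : (fun j : ℕ => (N j : ℝ)) =O[Filter.atTop] fun j : ℕ => Real.log j) (B p : ℕ) :
    ∃ c : ℕ, 0 < c ∧ ∀ m j : ℕ, j ≤ B * p ^ m → N j < c * (m + 1) := by
  obtain ⟨K, hK, hb⟩ := hN.exists_pos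
  rw [Asymptotics.isBigOWith_iff, Filter.eventually_atTop] at hb
  obtain ⟨j₀, hj₀⟩ := hb
  -- The sum absorbs the finitely many `j ≤ j₀`; beyond them `log (B * p ^ m) ≤ B + m * p` is used.
  refine ⟨⌈K⌉₊ * (B + p) + (∑ j ∈ Finset.range (j₀ + 1), N j) + 1, by omega, fun m j hj => ?_⟩
  rcases le_or_gt j j₀ with h | h
  · have h1 : N j ≤ ∑ j ∈ Finset.range (j₀ + 1), N j :=
      Finset.single_le_sum (f := N) (fun _ _ => Nat.zero_le _) (Finset.mem_range.2 (by omega))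
    nlinarith [Nat.zero_le (⌈K⌉₊ * (B + p)), Nat.zero_le m]
  · have hjpos : 0 < j := by omega
    have hB : 0 < B := Nat.pos_of_ne_zero (by rintro rfl; omega)
    have hp : 0 < p ^ m := Nat.pos_of_ne_zero (by intro h0; rw [h0] at hj; omega)
    have h1 := hj₀ j h.le
    rw [Real.norm_of_nonneg (Nat.cast_nonneg _),
      Real.norm_of_nonneg (Real.log_nonneg (by exact_mod_cast hjpos))] at h1
    have h2 : Real.log j ≤ B + m * p := by
      calc Real.log j ≤ Real.log (B * (p : ℝ) ^ m) :=
            Real.log_le_log (by exact_mod_cast hjpos) (by exact_mod_cast hj)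
        _ = Real.log B + m * Real.log p := by
            rw [Real.log_mul (by positivity) (by exact_mod_cast hp.ne'), Real.log_pow]
        _ ≤ B + m * p := by
            gcongr
            · exact Real.log_le_self (by positivity)
            · exact Real.log_le_self (by positivity)
    have h3 : (N j : ℝ) ≤ ⌈K⌉₊ * (B + m * p) :=
      h1.trans (mul_le_mul (Nat.le_ceil K) h2
        (Real.log_nonneg (by exact_mod_cast hjpos)) (by positivity))
    have h4 : N j ≤ ⌈K⌉₊ * (B + m * p) := by exact_mod_cast h3
    refine Nat.lt_of_le_of_lt h4 ?_
    have h5 : ⌈K⌉₊ * (B + m * p) ≤ ⌈K⌉₊ * ((B + p) * (m + 1)) :=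
      Nat.mul_le_mul_left _ (by nlinarith [Nat.zero_le (B * m)])
    nlinarith [Nat.zero_le m, Nat.zero_le ((∑ j ∈ Finset.range (j₀ + 1), N j) * (m + 1))]

/-- Choose `s` with `ρ ^ s * Y < 1`; eventually `s * (m + 2) ≤ p ^ m`. -/
theorem eventually_pow_pow_mul_pow_lt_one {p : ℕ} (hp : 1 < p) {ρ Y : ℝ} (hρ0 : 0 < ρ) (hρ1 : ρ < 1)
    (hY : 1 ≤ Y) : ∀ᶠ m : ℕ in Filter.atTop, ρ ^ p ^ m * Y ^ (m + 2) < 1 := by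
  obtain ⟨s, hs⟩ := exists_pow_lt_of_lt_one (show (0 : ℝ) < 1 / Y by positivity) hρ1
  have hp' : (1 : ℝ) < p := by exact_mod_cast hp
  have ht := (tendsto_pow_const_div_const_pow_of_one_lt 1 hp').comp (Filter.tendsto_add_atTop_nat 2)
  have hpos : (0 : ℝ) < 1 / ((s + 1) * p ^ 2) := by positivity
  filter_upwards [ht.eventually_lt_const hpos] with m hm
  simp only [Function.comp_apply, pow_one] at hm
  rw [div_lt_div_iff₀ (by positivity) (by positivity), one_mul, pow_add, ← mul_assoc] at hm
  have hm' : ((m + 2 : ℕ) : ℝ) * (s + 1) < p ^ m := lt_of_mul_lt_mul_right hm (by positivity)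
  have hle : s * (m + 2) ≤ p ^ m := by
    have : (m + 2) * (s + 1) < p ^ m := by exact_mod_cast hm'
    nlinarith
  rw [lt_div_iff₀ (by positivity)] at hs
  calc ρ ^ p ^ m * Y ^ (m + 2) ≤ ρ ^ (s * (m + 2)) * Y ^ (m + 2) := by
        gcongr ?_ * _
        exact pow_le_pow_of_le_one hρ0.le hρ1.le hle
    _ = (ρ ^ s * Y) ^ (m + 2) := by rw [pow_mul, mul_pow]
    _ < 1 := pow_lt_one₀ (by positivity) hs (by omega)

end Growth

/-! ### Eventual vanishing of the coefficients of the measure. -/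

section Coefficients

variable {Fr : Type*} [Field Fr] [Finite Fr] {k : Type*} [Field k] [Algebra Fr k]
  {inf : Place Fr k}

theorem norm_coeffIn (P : Place Fr k) (b : NzIdeal inf → affineRing inf) (I : NzIdeal inf) :
    ‖coeffIn P b I‖ = P.abv (b I : k) :=
  P.norm_algebraMap_CC _

instance (P : Place Fr k) (p : ℕ) [CharP Fr p] : CharP P.CC p :=
  charP_of_injective_ringHom ((algebraMap k P.CC).comp (algebraMap Fr k)).injective p

end Coefficients

section Vanishing

variable {Fr : Type*} [Field Fr] [Finite Fr] {k : Type*} [Field k] [Algebra Fr k]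
  [IsGlobalFunctionField Fr k] {inf : Place Fr k}

/-- The finitely many ideals of degree `d`. -/
noncomputable def idealsOfDeg (inf : Place Fr k) (d : ℕ) : Finset (NzIdeal inf) :=
  (finite_setOf_idealDeg_eq (inf := inf) d).toFinset

theorem mem_idealsOfDeg {d : ℕ} {I : NzIdeal inf} : I ∈ idealsOfDeg inf d ↔ idealDeg I = d := by
  simp [idealsOfDeg]

-- The common core of both cases. The hypothesis `hR` discards values outside `R`, where the
-- polynomial approximation says nothing.
open Classical in
theorem sum_indicator_eq_zero {p : ℕ} [Fact p.Prime] [CharP Fr p] (v : Place Fr k)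
    (b : NzIdeal inf → affineRing inf) (z : NzIdeal inf → v.CC) {X : ℝ} (hX : 1 ≤ X) {D₀ : ℕ}
    (hbX : ∀ I : NzIdeal inf, D₀ ≤ idealDeg I →
      inf.abv (b I : k) ≤ X ^ idealDeg I ∧ v.abv (b I : k) ≤ X ^ idealDeg I)
    {N : ℕ → ℕ} (hN : (fun j : ℕ => (N j : ℝ)) =O[Filter.atTop] fun j : ℕ => Real.log j)
    (hsum : ∀ j d, N j < d → ∑ I ∈ idealsOfDeg inf d, coeffIn v b I * z I ^ j = 0)
    {F : Subfield v.CC} {R : Set v.CC} (hRF : R = {z | z ∈ F ∧ ‖z‖ ≤ 1})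
    (hF : ∀ a : k, algebraMap k v.CC a ∈ F)
    (hR : ∀ d, ∀ G : v.CC → v.CC,
      ∑ I ∈ idealsOfDeg inf d with z I ∉ R, coeffIn v b I * G (z I) = 0)
    (U : Set R) (hU : IsCompact U) (hUo : IsOpen U) :
    ∃ D, ∀ d ≥ D, ∑ I ∈ idealsOfDeg inf d, coeffIn v b I * dirac (z I) U = 0 := by
  obtain ⟨ϖ, hϖ0, hϖ1⟩ := v.exists_abv_lt_one
  rw [← v.norm_algebraMap_CC] at hϖ0 hϖ1
  obtain ⟨P, ρ, hρ0, hρ1, hP⟩ := exists_polynomial_pow_approx_indicator p hRF (hF ϖ) hϖ0 hϖ1 U hU hUo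
  obtain ⟨e, he⟩ := exists_one_le_abv_mul_abv_pow inf v
  obtain ⟨c, hc, hcN⟩ := exists_lt_mul_of_isBigO_log hN P.natDegree p
  obtain ⟨M, hM⟩ := Filter.eventually_atTop.1 (eventually_pow_pow_mul_pow_lt_one
    (Fact.out : p.Prime).one_lt hρ0 hρ1 (one_le_pow₀ hX : 1 ≤ X ^ (c * (1 + e))))
  refine ⟨D₀ + c * (M + 1), fun d hd => ?_⟩
  -- The lower bound on `d` makes all needed power sums vanish; the upper bound keeps `X ^ d` simply
  -- exponential in `m`.
  obtain ⟨m, hmM, hm1, hm2⟩ : ∃ m ≥ M, c * (m + 1) ≤ d ∧ d ≤ c * (m + 2) := by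
    have h1 : M + 1 ≤ d / c := by
      rw [Nat.le_div_iff_mul_le hc]
      nlinarith
    refine ⟨d / c - 1, by omega, ?_, ?_⟩
    · rw [Nat.sub_add_cancel (by omega)]
      exact Nat.mul_div_le d c
    · have h2 : d / c - 1 + 2 = d / c + 1 := by omega
      rw [h2]
      exact (Nat.lt_mul_div_succ d hc).le
  let a : affineRing inf := ∑ I ∈ idealsOfDeg inf d with z I ∈ Subtype.val '' U, b I
  have hD : ∀ I ∈ idealsOfDeg inf d, D₀ ≤ idealDeg I ∧ idealDeg I = d := fun I hI => by
    rw [mem_idealsOfDeg.1 hI]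
    exact ⟨by omega, rfl⟩
  have ha : algebraMap k v.CC (a : k) =
      ∑ I ∈ idealsOfDeg inf d, coeffIn v b I * dirac (z I) U := by
    simp only [a, dirac, mul_ite, mul_one, mul_zero, ← Finset.sum_filter]
    rw [AddSubmonoidClass.coe_finsetSum, map_sum]
    rfl
  rw [← ha]
  by_contra hne
  have ha0 : (a : k) ≠ 0 := fun h => hne (by rw [h, map_zero])
  have hinf : inf.abv (a : k) ≤ X ^ d := by
    rw [← inf.norm_algebraMap_CC]
    simp only [a]
    rw [AddSubmonoidClass.coe_finsetSum, map_sum]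
    refine IsUltrametricDist.norm_sum_le_of_forall_le_of_nonneg (by positivity) fun I hI => ?_
    have h := hD I (Finset.mem_filter.1 hI).1
    rw [inf.norm_algebraMap_CC, ← h.2]
    exact (hbX I h.1).1
  have hvan : ∑ I ∈ idealsOfDeg inf d with z I ∈ R, coeffIn v b I * P.eval (z I) ^ p ^ m = 0 := by
    have h1 := sum_mul_eval_eq_zero (idealsOfDeg inf d) (coeffIn v b) z (P.natDegree * p ^ m)
      (fun j hj => hsum j d ((hcN m j hj).trans_le hm1)) (P ^ p ^ m)
      (by rw [Polynomial.natDegree_pow, mul_comm])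
    simp only [Polynomial.eval_pow] at h1
    rw [← Finset.sum_filter_add_sum_filter_not _ (fun I => z I ∈ R),
      hR d (fun w => P.eval w ^ p ^ m), add_zero] at h1
    exact h1
  have hv : v.abv (a : k) ≤ ρ ^ p ^ m * X ^ d := by
    rw [← v.norm_algebraMap_CC, ha]
    -- Subtracting the vanishing sum replaces the indicator by its approximation error.
    have h1 : ∑ I ∈ idealsOfDeg inf d, coeffIn v b I * dirac (z I) U =
        ∑ I ∈ idealsOfDeg inf d with z I ∈ R,
          coeffIn v b I * (dirac (z I) U - P.eval (z I) ^ p ^ m) := by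
      simp only [mul_sub]
      rw [Finset.sum_sub_distrib, hvan, sub_zero, Finset.sum_filter]
      refine Finset.sum_congr rfl fun I _ => ?_
      split_ifs with hI
      · rfl
      · rw [dirac, if_neg, mul_zero]
        rintro ⟨w, _, hw⟩
        exact hI (hw ▸ w.2)
    rw [h1]
    refine IsUltrametricDist.norm_sum_le_of_forall_le_of_nonneg (by positivity) fun I hI => ?_
    have h := hD I (Finset.mem_filter.1 hI).1
    rw [norm_mul, norm_coeffIn, mul_comm, norm_sub_rev]
    refine mul_le_mul (hP _ (Finset.mem_filter.1 hI).2 m) ?_ (AbsoluteValue.nonneg _ _)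
      (by positivity)
    rw [← h.2]
    exact (hbX I h.1).2
  have hlow := he a a.2 ha0
  refine hlow.not_gt (lt_of_le_of_lt ?_ (hM m hmM))
  calc v.abv (a : k) * inf.abv (a : k) ^ e ≤ (ρ ^ p ^ m * X ^ d) * (X ^ d) ^ e := by gcongr
    _ = ρ ^ p ^ m * X ^ (d * (1 + e)) := by rw [mul_assoc, ← pow_mul, ← pow_add]; ring_nf
    _ ≤ ρ ^ p ^ m * X ^ (c * (m + 2) * (1 + e)) := by gcongr
    _ = ρ ^ p ^ m * (X ^ (c * (1 + e))) ^ (m + 2) := by rw [← pow_mul]; ring_nf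

/-- A convergent series over the ideals whose partial sums by degree are eventually zero is a
polynomial in the variable recording the degree. -/
theorem exists_polynomial_tsum_eq {C : Type*} [NormedField C]
    (g : NzIdeal inf → C) {D : ℕ} (hD : ∀ d ≥ D, ∑ I ∈ idealsOfDeg inf d, g I = 0) :
    ∃ Q : Polynomial C, ∀ (y : C) (f : NzIdeal inf → C), (∀ I, f I = g I * y ^ idealDeg I) →
      Summable f → ∑' I, f I = Q.eval y := by
  classical
  refine ⟨∑ d ∈ Finset.range D,
    Polynomial.C (∑ I ∈ idealsOfDeg inf d, g I) * Polynomial.X ^ d, fun y f hf hs => ?_⟩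
  let S : ℕ → Finset (NzIdeal inf) := fun n => (Finset.range n).biUnion (idealsOfDeg inf)
  have hmem : ∀ n I, I ∈ S n ↔ idealDeg I < n := fun n I => by
    simp [S, mem_idealsOfDeg]
  have hS : Filter.Tendsto S Filter.atTop Filter.atTop := by
    refine Filter.tendsto_atTop_finset_of_monotone (fun n m hnm I hI => ?_)
      fun I => ⟨idealDeg I + 1, by simp [hmem]⟩
    rw [hmem] at hI ⊢
    omega
  have hsum : ∀ n, ∑ I ∈ S n, f I =
      ∑ d ∈ Finset.range n, (∑ I ∈ idealsOfDeg inf d, g I) * y ^ d := fun n => by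
    rw [Finset.sum_biUnion]
    · refine Finset.sum_congr rfl fun d _ => ?_
      rw [Finset.sum_mul]
      exact Finset.sum_congr rfl fun I hI => by rw [hf, mem_idealsOfDeg.1 hI]
    · intro d _ d' _ hne
      refine Finset.disjoint_left.2 fun I hI hI' => hne ?_
      rw [← mem_idealsOfDeg.1 hI, ← mem_idealsOfDeg.1 hI']
  refine tendsto_nhds_unique (hs.hasSum.comp hS) (tendsto_const_nhds.congr' ?_)
  filter_upwards [Filter.eventually_ge_atTop D] with n hn
  rw [Function.comp_apply, hsum, Polynomial.eval_finsetSum,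
    ← Finset.sum_subset (Finset.range_mono hn)]
  · simp only [Polynomial.eval_mul, Polynomial.eval_C, Polynomial.eval_pow, Polynomial.eval_X]
  · intro d _ hd
    rw [hD d (by simpa using hd), zero_mul]

/-- In a complete ultrametric field terms tending to zero suffice, and each degree occurs only
finitely often. -/
theorem summable_of_tendsto_comap_idealDeg {P : Place Fr k} {f : NzIdeal inf → P.CC}
    (h : Filter.Tendsto f (Filter.comap idealDeg Filter.atTop) (nhds 0)) : Summable f :=
  NonarchimedeanAddGroup.summable_of_tendsto_cofinite_zero
    (h.mono_left (Filter.map_le_iff_le_comap.1 tendsto_idealDeg_cofinite))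

end Vanishing

theorem norm_le_one_of_eval₂_eq_zero {C A : Type*} [NormedField C] [IsUltrametricDist C]
    [CommRing A] (f : A →+* C) (hf : ∀ a, ‖f a‖ ≤ 1) {q : Polynomial A} (hq : q.Monic) {x : C}
    (hx : q.eval₂ f x = 0) : ‖x‖ ≤ 1 := by
  by_contra! h
  rw [Polynomial.eval₂_eq_sum_range, Finset.sum_range_succ, hq.coeff_natDegree, map_one,
    one_mul] at hx
  -- The leading term cannot be matched by lower ones when `‖x‖ > 1`. The integer exponent also
  -- covers degree 0.
  have h1 : ‖x ^ q.natDegree‖ ≤ ‖x‖ ^ (q.natDegree - 1 : ℤ) := by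
    rw [eq_neg_of_add_eq_zero_right hx, norm_neg]
    refine IsUltrametricDist.norm_sum_le_of_forall_le_of_nonneg (by positivity) fun i hi => ?_
    rw [norm_mul, norm_pow]
    refine (mul_le_of_le_one_left (by positivity) (hf _)).trans ?_
    rw [← zpow_natCast]
    refine zpow_le_zpow_right₀ h.le ?_
    have := Finset.mem_range.1 hi
    omega
  rw [norm_pow, ← zpow_natCast] at h1
  have := (zpow_le_zpow_iff_right₀ h).1 h1
  omega

/-! ### Motivic Dirichlet series at `∞` and at `v`. -/

section Motivic

variable {Fr : Type*} [Field Fr] [Finite Fr] {k : Type*} [Field k] [Algebra Fr k]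
  {inf : Place Fr k}

open Classical in
theorem norm_angleHom_sub_one (π : inf.Completion) (I : NzIdeal inf) :
    ‖angleHom π I - 1‖ < 1 := by
  unfold angleHom
  split_ifs with h
  · exact h.choose_spec.1 I
  -- The default value 1 is a one-unit as well.
  · simp

theorem angleHom_mem_A1 (π : inf.Completion) (I : NzIdeal inf) : angleHom π I ∈ A1 π :=
  ⟨IntermediateField.subset_adjoin _ _ ⟨I, rfl⟩,
    norm_le_one_of_sub_one (norm_angleHom_sub_one π I).le⟩

theorem uniformizer_root_ne_zero {π : inf.Completion} (hπ : IsUniformizer π) {πs : inf.CC}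
    (hπs : πs ^ inf.deg = algebraMap inf.Completion inf.CC π) : πs ≠ 0 := by
  rintro rfl
  rw [zero_pow inf.deg_pos.ne', eq_comm, map_eq_zero] at hπs
  subst hπs
  have h : (0 : ℝ) < (inf.q : ℝ)⁻¹ := by
    have := inf.one_lt_q
    have : (0 : ℝ) < inf.q := by exact_mod_cast zero_lt_one.trans this
    positivity
  rw [IsUniformizer, norm_zero] at hπ
  exact h.ne hπ

theorem ConvergesAbsolutely.tendsto {p : ℕ} [Fact p.Prime] {π : inf.Completion}
    {b : NzIdeal inf → affineRing inf} {t : ℝ} (h : ConvergesAbsolutely p π b t) {x : inf.CC}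
    (hx : t ≤ ‖x‖) :
    Filter.Tendsto (fun I => coeffIn inf b I * x⁻¹ ^ idealDeg I)
      (Filter.comap idealDeg Filter.atTop) (nhds 0) := by
  refine (h x 0 hx).congr fun I => ?_
  have h0 : (-0 : ℤ_[p]) = ((0 : ℕ) : ℤ_[p]) := by simp
  rw [idealPow, h0, oneUnitPow_natCast, pow_zero, mul_one]

/-- Convergence at a single `x` of large norm bounds the coefficients: take `x = a⁻¹ ^ n` and `X =
‖x‖`. -/
theorem ConvergesAbsolutely.exists_bound {p : ℕ} [Fact p.Prime] {π : inf.Completion}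
    {b : NzIdeal inf → affineRing inf} {t : ℝ} (h : ConvergesAbsolutely p π b t) :
    ∃ X : ℝ, 1 ≤ X ∧ ∃ D : ℕ, ∀ I, D ≤ idealDeg I → inf.abv (b I : k) ≤ X ^ idealDeg I := by
  obtain ⟨a, ha0, ha1⟩ := inf.exists_abv_lt_one
  obtain ⟨n, hn⟩ := pow_unbounded_of_one_lt t ((one_lt_inv₀ ha0).2 ha1)
  let x : inf.CC := algebraMap k inf.CC (a⁻¹ ^ n)
  have hx : ‖x‖ = (inf.abv a)⁻¹ ^ n := by
    rw [inf.norm_algebraMap_CC, map_pow, map_inv₀]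
  have hx1 : 1 ≤ ‖x‖ := by
    rw [hx]
    exact one_le_pow₀ ((one_lt_inv₀ ha0).2 ha1).le
  have ht := (h.tendsto (x := x) (hx ▸ hn.le)).norm.eventually_lt_const
    (show ‖(0 : inf.CC)‖ < 1 by simp)
  rw [Filter.eventually_comap, Filter.eventually_atTop] at ht
  obtain ⟨D, hD⟩ := ht
  refine ⟨‖x‖, hx1, D, fun I hI => ?_⟩
  have := hD _ hI I rfl
  rw [norm_mul, norm_pow, norm_inv, inv_pow, ← div_eq_mul_inv, div_lt_one (by positivity),
    norm_coeffIn] at this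
  exact this.le

/-- `σ` transports the monic equation over `A` to `ℂ_v`, where elements of `A` have norm at most 1.
-/
theorem norm_toCC_le_one_of_isIntegral {π : inf.Completion} {πs : inf.CC} {v : Place Fr k} (hv : v ≠ inf)
    (σ : valueField π πs →ₐ[k] v.AlgCl) {x : valueField π πs}
    (hx : IsIntegral (affineRing inf) (x : inf.CC)) : ‖v.toCC (σ x)‖ ≤ 1 := by
  obtain ⟨q, hq, hqx⟩ := hx
  let f : affineRing inf →+* v.CC := (algebraMap k v.CC).comp (affineRing inf).val.toRingHom
  refine norm_le_one_of_eval₂_eq_zero f (fun a => ?_) hq ?_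
  · change ‖algebraMap k v.CC (a : k)‖ ≤ 1
    rw [v.norm_algebraMap_CC, v.abv_le_one_iff]
    exact val_le_one_of_mem_affineRing a.2 hv
  · let g : affineRing inf →+* valueField π πs :=
      (algebraMap k (valueField π πs)).comp (affineRing inf).val.toRingHom
    have h1 : q.eval₂ g x = 0 := by
      apply Subtype.val_injective
      have h2 := Polynomial.hom_eval₂ q g (valueField π πs).val.toRingHom x
      exact h2.trans hqx
    have h3 := Polynomial.hom_eval₂ q g (v.toCC.comp σ.toRingHom) x
    rw [h1, map_zero] at h3
    have h4 : (v.toCC.comp σ.toRingHom).comp g = f := by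
      ext a
      exact congrArg v.toCC (σ.commutes (a : k))
    rw [h4] at h3
    exact h3.symm

variable [IsGlobalFunctionField Fr k]

theorem seriesCoeff_neg_natCast (p : ℕ) [Fact p.Prime] (π : inf.Completion)
    (b : NzIdeal inf → affineRing inf) (j d : ℕ) :
    seriesCoeff p π b (-(j : ℤ_[p])) d =
      ∑ I ∈ idealsOfDeg inf d, coeffIn inf b I * angleHom π I ^ j := by
  unfold seriesCoeff
  simp only [neg_neg, oneUnitPow_natCast]
  have h := finsum_set_coe_eq_finsum_mem (f := fun I => coeffIn inf b I * angleHom π I ^ j)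
    {I : NzIdeal inf | idealDeg I = d}
  exact h.trans (finsum_mem_eq_finite_toFinset_sum _ (finite_setOf_idealDeg_eq d))

/-- Replacing `x` by `π_* ^ j x` turns `⟨I⟩ ^ j` into `(I ^ {s_1}) ^ j`, so the motivic condition is
one on power sums. -/
theorem specialCoeff_eq_sum (p : ℕ) [Fact p.Prime] (π : inf.Completion) (πs : inf.CC)
    (b : NzIdeal inf → affineRing inf) (j d : ℕ) :
    specialCoeff p π πs b j d =
      ∑ I ∈ idealsOfDeg inf d, coeffIn inf b I * idealPowOne π πs I ^ j := by
  rw [specialCoeff, seriesCoeff_neg_natCast, Finset.sum_mul]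
  refine Finset.sum_congr rfl fun I hI => ?_
  rw [idealPowOne, mem_idealsOfDeg.1 hI, mul_pow, ← pow_mul, inv_pow, inv_pow, ← pow_mul,
    mul_comm d j]
  ring

variable {p : ℕ} [Fact p.Prime] [CharP Fr p] {π : inf.Completion} {πs : inf.CC}
  {b : NzIdeal inf → affineRing inf}

/-- The element `∑_{deg I = d} b_I (I ^ {s_1}) ^ j` of the value field. -/
noncomputable def valueSum (π : inf.Completion) (πs : inf.CC)
    (b : NzIdeal inf → affineRing inf) (j d : ℕ) :
    valueField π πs :=
  ∑ I ∈ idealsOfDeg inf d, algebraMap k (valueField π πs) (b I : k) * idealPowOneV π πs I ^ j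

theorem coe_valueSum (p : ℕ) [Fact p.Prime] (π : inf.Completion) (πs : inf.CC)
    (b : NzIdeal inf → affineRing inf) (j d : ℕ) :
    (valueSum π πs b j d : inf.CC) = specialCoeff p π πs b j d := by
  rw [specialCoeff_eq_sum, valueSum, AddSubmonoidClass.coe_finsetSum]
  rfl

theorem toCC_valueSum (v : Place Fr k) (σ : valueField π πs →ₐ[k] v.AlgCl) (j d : ℕ) :
    v.toCC (σ (valueSum π πs b j d)) =
      ∑ I ∈ idealsOfDeg inf d, coeffIn v b I * v.toCC (σ (idealPowOneV π πs I)) ^ j := by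
  rw [valueSum, map_sum, map_sum]
  refine Finset.sum_congr rfl fun I _ => ?_
  rw [map_mul, map_mul, map_pow, map_pow, AlgHom.commutes]
  rfl

/-- Removing the nonzero power of `πs` gives vanishing power sums of the `⟨I⟩`, all of which lie in
`A_{1,∞}`. -/
theorem exists_polynomial_canonicalMeasure (hπs : πs ≠ 0) (hb : IsMotivic p π πs b)
    (U : Set (A1 π)) (hU : IsCompact U) (hUo : IsOpen U) :
    ∃ Q : Polynomial inf.CC, ∀ t : ℝ, 0 < t → ConvergesAbsolutely p π b t →
      ∀ x : inf.CC, t ≤ ‖x‖ →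
        Summable (measTerm π b x U) ∧ canonicalMeasure π b x U = Q.eval x⁻¹ := by
  classical
  obtain ⟨t₀, _, ht₀⟩ := hb.half_plane
  obtain ⟨X, hX, D₀, hD₀⟩ := ht₀.exists_bound
  obtain ⟨z, hz, _, hN⟩ := hb.special
  have hsum : ∀ j d, (z j).natDegree < d →
      ∑ I ∈ idealsOfDeg inf d, coeffIn inf b I * angleHom π I ^ j = 0 := by
    intro j d hd
    have h := hz j d
    rw [Polynomial.coeff_eq_zero_of_natDegree_lt hd, specialCoeff, eq_comm, mul_eq_zero] at h
    rw [← seriesCoeff_neg_natCast p]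
    exact h.resolve_right (pow_ne_zero _ (inv_ne_zero (pow_ne_zero _ hπs)))
  obtain ⟨D, hD⟩ := sum_indicator_eq_zero (p := p) inf b (angleHom π) hX
    (fun I hI => ⟨hD₀ I hI, hD₀ I hI⟩) hN hsum (F := (K1 π).toSubfield) (R := A1 π) rfl
    (fun a => (K1 π).algebraMap_mem (algebraMap k inf.Completion a))
    (fun d G => by
      rw [Finset.filter_false_of_mem fun I _ => not_not.2 (angleHom_mem_A1 π I),
        Finset.sum_empty]) U hU hUo
  obtain ⟨Q, hQ⟩ := exists_polynomial_tsum_eq _ hD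
  refine ⟨Q, fun t _ ht x hx => ?_⟩
  have hs : Summable (measTerm π b x U) := by
    refine summable_of_tendsto_comap_idealDeg (squeeze_zero_norm (fun I => ?_)
      (tendsto_zero_iff_norm_tendsto_zero.1 (ht.tendsto hx)))
    rw [measTerm, norm_mul]
    refine mul_le_of_le_one_right (norm_nonneg _) ?_
    unfold dirac
    split_ifs <;> simp
  exact ⟨hs, hQ x⁻¹ _ (fun I => by rw [measTerm]; ring) hs⟩

/-- The power sums live in `𝕍`, so `σ` carries both their vanishing and their integrality to `v`.
Integrality bounds them by 1, which disposes of values outside `A_{σ,v}`; `|b_I|_v ≤ 1` gives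
convergence for `|x_v| > 1`. -/
theorem exists_polynomial_canonicalMeasureV (hb : IsMotivic p π πs b) {v : Place Fr k}
    (hv : v ≠ inf) (σ : valueField π πs →ₐ[k] v.AlgCl) (U : Set (Aσ v σ)) (hU : IsCompact U)
    (hUo : IsOpen U) :
    ∃ Q : Polynomial v.CC, ∀ t : ℝ, 1 < t → ∀ x : v.CC, t ≤ ‖x‖ →
      Summable (measTermV b v σ x U) ∧ canonicalMeasureV b v σ x U = Q.eval x⁻¹ := by
  classical
  obtain ⟨t₀, _, ht₀⟩ := hb.half_plane
  obtain ⟨X, hX, D₀, hD₀⟩ := ht₀.exists_bound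
  obtain ⟨z, hz, hint, hN⟩ := hb.special
  have hbv : ∀ I, v.abv (b I : k) ≤ 1 := fun I =>
    (v.abv_le_one_iff _).2 (val_le_one_of_mem_affineRing (b I).2 hv)
  have hcoe : ∀ j d, (valueSum π πs b j d : inf.CC) = (z j).coeff d := fun j d =>
    (coe_valueSum p π πs b j d).trans (hz j d).symm
  have hsum : ∀ j d, (z j).natDegree < d →
      ∑ I ∈ idealsOfDeg inf d, coeffIn v b I * v.toCC (σ (idealPowOneV π πs I)) ^ j = 0 := by
    intro j d hd
    have h := hcoe j d
    rw [Polynomial.coeff_eq_zero_of_natDegree_lt hd] at h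
    have h0 : valueSum π πs b j d = 0 := Subtype.ext h
    rw [← toCC_valueSum, h0, map_zero, map_zero]
  have hbounded : ∀ d j,
      ‖∑ I ∈ idealsOfDeg inf d, coeffIn v b I * v.toCC (σ (idealPowOneV π πs I)) ^ j‖ ≤ 1 := by
    intro d j
    rw [← toCC_valueSum]
    refine norm_toCC_le_one_of_isIntegral hv σ ?_
    rw [hcoe]
    exact (hint j d).2
  have hmem : ∀ I, v.toCC (σ (idealPowOneV π πs I)) ∈ kσ v σ := fun I =>
    IntermediateField.subset_adjoin _ _ ⟨_, rfl⟩
  obtain ⟨D, hD⟩ := sum_indicator_eq_zero (p := p) v b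
    (fun I => v.toCC (σ (idealPowOneV π πs I))) hX
    (fun I hI => ⟨hD₀ I hI, (hbv I).trans (one_le_pow₀ hX)⟩) hN hsum
    (F := (kσ v σ).toSubfield) (R := Aσ v σ) rfl
    (fun a => (kσ v σ).algebraMap_mem (algebraMap k v.Completion a))
    (fun d G => by
      rw [← sum_filter_one_lt_norm_eq_zero _ _ _ 1 (hbounded d) G]
      refine Finset.sum_congr (Finset.filter_congr fun I _ => ?_) fun _ _ => rfl
      rw [← not_le, not_iff_not]
      exact ⟨And.right, fun h => ⟨hmem I, h⟩⟩) U hU hUo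
  obtain ⟨Q, hQ⟩ := exists_polynomial_tsum_eq _ hD
  refine ⟨Q, fun t ht x hx => ?_⟩
  have hs : Summable (measTermV b v σ x U) := by
    have hx1 : ‖x‖⁻¹ < 1 := inv_lt_one_of_one_lt₀ (ht.trans_le hx)
    refine summable_of_tendsto_comap_idealDeg (squeeze_zero_norm (fun I => ?_)
      ((tendsto_pow_atTop_nhds_zero_of_lt_one (inv_nonneg.2 (norm_nonneg x)) hx1).comp
        Filter.tendsto_comap))
    rw [measTermV, norm_mul, norm_mul, norm_pow, norm_inv, norm_coeffIn]
    have hdirac : ‖dirac (v.toCC (σ (idealPowOneV π πs I))) U‖ ≤ 1 := by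
      unfold dirac
      split_ifs <;> simp
    refine (mul_le_of_le_one_right (by positivity) hdirac).trans ?_
    exact mul_le_of_le_one_left (by positivity) (hbv I)
  exact ⟨hs, hQ x⁻¹ _ (fun I => by rw [measTermV]; ring) hs⟩

end Motivic

end FunctionFieldMeasure

theorem corollary4p4 {p : ℕ} [Fact p.Prime] {Fr : Type*} [Field Fr] [Finite Fr] [CharP Fr p]
    {k : Type*} [Field k] [Algebra Fr k] [IsGlobalFunctionField Fr k]
    (inf : Place Fr k)
    (π : inf.Completion) (hπ : IsUniformizer π)
    (πs : inf.CC) (hπs : πs ^ inf.deg = algebraMap inf.Completion inf.CC π)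
    (b : NzIdeal inf → affineRing inf) (hb : IsMotivic p π πs b) :
    (∀ U : Set (A1 π), IsCompact U → IsOpen U →
      ∃ Q : Polynomial inf.CC, ∀ t : ℝ, 0 < t → ConvergesAbsolutely p π b t →
        ∀ x : inf.CC, t ≤ ‖x‖ →
          Summable (measTerm π b x U) ∧ canonicalMeasure π b x U = Q.eval x⁻¹) ∧
    (∀ v : Place Fr k, v ≠ inf → ∀ (σ : valueField π πs →ₐ[k] v.AlgCl) (U : Set (Aσ v σ)),
      IsCompact U → IsOpen U →
      ∃ Q : Polynomial v.CC, ∀ t : ℝ, 1 < t →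
        ∀ x : v.CC, t ≤ ‖x‖ →
          Summable (measTermV b v σ x U) ∧ canonicalMeasureV b v σ x U = Q.eval x⁻¹) :=
  ⟨exists_polynomial_canonicalMeasure (uniformizer_root_ne_zero hπ hπs) hb,
    fun _ hv σ => exists_polynomial_canonicalMeasureV hb hv σ⟩
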